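/- Let $k\ge 1$ be an integer, $\rho>0$, $\kappa=-1/\rho^2$, and let $B$ be the ball model of $(k+1)$-dimensional hyperbolic space of curvature $\kappa$, i.e. the Euclidean ball $\{m\in\mathbb R^{k+1}:|m|<\rho\}$ with the metric $\frac{2\rho^2|dm|}{\rho^2-|m|^2}$ and Laplacian $\triangle$. A point of Euclidean norm $\eta$ has hyperbolic distance $r(\eta)=\rho\ln\frac{\rho+\eta}{\rho-\eta}$ from the origin. For real $\lambda$, let $\varphi_\lambda(r)$ be the unique radial eigenfunction with eigenvalue $\lambda$ that equals $1$ at the origin, i.e. the unique function of the hyperbolic distance $r\in[0,\infty)$ to the origin that is (possibly complex-valued and) $C^2$ as a function on $B$, satisfies $\triangle\varphi_\lambda+\lambda\varphi_\lambda=0$ on $B$, and has $\varphi_\lambda(0)=1$; such a function exists and is unique. Theorem. Let $\lambda$ be real. Then $\varphi_\lambda(r)=0$ for some finite $r\ge 0$ if and only if $\lambda>-\kappa k^2/4$, or equivalently, if and only if $$\lambda=\frac{\alpha k-\alpha^2}{\rho^2}\quad\text{for some}\quad\alpha=\frac k2+ib,\ b\in\mathbb R,\ b\ne0.$$ If this is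 the case, then: 1. $\varphi_\lambda$ is real-valued and changes sign infinitely many times: for every $R$ it takes both a negative and a positive value on $(R,\infty)$; 2. $\varphi_\lambda(r)\to0$ as $r\to\infty$; 3. there exist positive constants $T_1,T_2,\Lambda_0$ such that $T_1<|r_2-r_1|<T_2$ for every two successive zeros $r_1,r_2$ of $\varphi_\lambda$ with $r_2>r_1>\Lambda_0$; 4. $b:=\sqrt{\frac{\lambda}{-\kappa}-\frac{k^2}{4}}>0$ and, for every $u\in\mathbb R^{k+1}$ with $|u|=\rho$ and every $\eta\in(0,\rho)$, $$\varphi_\lambda(r(\eta))=\frac1{|S(\eta)|}\int_{S(\eta)}\omega^{k/2\pm ib}(u,m)\,dS_m\quad\text{(for either sign)}$$ and $$\varphi_\lambda(r(\eta))=\frac1{|S(\eta)|}\int_{S(\eta)}\omega^{k/2}\cos\left(\sqrt{\frac{\lambda}{-\kappa}-\frac{k^2}{4}}\,\ln\omega\right)dS_m,$$ where $S(\eta)$ is the Euclidean sphere of radius $\eta$ about the origin $O$ with its surface measure $dS$ and, for $|m|=\eta$ and $\theta=\pi-\widehat{uOm}$, $$\omega=\omega(u,m)=\frac{\rho^2-\eta^2}{|u-m|^2}=\frac{\rho^2-\eta^2}{\rho^2+\eta^2+2\eta\rho\cos\theta}.$$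 -/

import Mathlib

open MeasureTheory Set Filter Topology

noncomputable section

/-- The ambient Euclidean space `ℝ^(k+1)` of the ball model of `(k+1)`-dimensional hyperbolic
space. -/
abbrev Eucl (k : ℕ) : Type := EuclideanSpace ℝ (Fin (k + 1))

/-- The conformal factor `σ(m) = 2ρ² / (ρ² - |m|²)` of the ball model: on the Euclidean ball of
radius `ρ`, the hyperbolic metric of curvature `-1/ρ²` is `σ(m)² |dm|²`. -/
def conformalFactor (k : ℕ) (ρ : ℝ) (m : Eucl k) : ℝ :=
  2 * ρ ^ 2 / (ρ ^ 2 - ‖m‖ ^ 2)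

/-- The `i`-th partial derivative. -/
def partialDeriv {k : ℕ} (i : Fin (k + 1)) (F : Eucl k → ℂ) (m : Eucl k) : ℂ :=
  fderiv ℝ F m (EuclideanSpace.single i 1)

/-- The hyperbolic Laplacian of the ball model of dimension `n = k + 1 ≥ 2`, that is, the
Laplace-Beltrami operator `(det g)^(-1/2) ∑ ∂ᵢ ((det g)^(1/2) gⁱʲ ∂ⱼ F)` of the metric
`g = σ² |dm|²`, for which `(det g)^(1/2) = σ^(k+1)` and `gⁱʲ = σ^(-2) δᵢⱼ`. -/
def hyperbolicLaplacian (k : ℕ) (ρ : ℝ) (F : Eucl k → ℂ) (m : Eucl k) : ℂ :=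
  ((conformalFactor k ρ m : ℂ) ^ (k + 1))⁻¹ *
    ∑ i : Fin (k + 1),
      partialDeriv i (fun x => (conformalFactor k ρ x : ℂ) ^ (k - 1) * partialDeriv i F x) m

/-- The hyperbolic distance `r(η)` from the origin to a point of Euclidean norm `η` in the ball
model. -/
def hyperbolicRadius (ρ η : ℝ) : ℝ :=
  ρ * Real.log ((ρ + η) / (ρ - η))

/-- `φ`, as a function of the hyperbolic distance `r ≥ 0` to the origin, is the radial
eigenfunction of the hyperbolic Laplacian with eigenvalue `μ` (in the convention
`Δ φ + μ φ = 0`) that assumes the value `1` at the origin. -/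
structure IsNormalizedRadialEigenfunction (k : ℕ) (ρ : ℝ) (μ : ℂ) (φ : ℝ → ℂ) : Prop where
  contDiffOn : ContDiffOn ℝ 2 (fun m : Eucl k => φ (hyperbolicRadius ρ ‖m‖)) (Metric.ball 0 ρ)
  eigen : ∀ m ∈ Metric.ball (0 : Eucl k) ρ,
    hyperbolicLaplacian k ρ (fun x => φ (hyperbolicRadius ρ ‖x‖)) m
      + μ * φ (hyperbolicRadius ρ ‖m‖) = 0
  at_origin : φ 0 = 1

/-- The kernel `ω(u, m) = (|u|² - |m|²) / |u - m|²`, for `|m| < |u|`. -/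
def omegaKernel {k : ℕ} (u m : Eucl k) : ℝ :=
  (‖u‖ ^ 2 - ‖m‖ ^ 2) / ‖u - m‖ ^ 2

/-- The Euclidean surface measure `dS` of the `k`-dimensional sphere `S(η)` of radius `η > 0`
about the origin: the image of the surface measure of the unit sphere under `s ↦ η s`,
multiplied by `η^k`. -/
def sphereMeasure (k : ℕ) (η : ℝ) : Measure (Eucl k) :=
  ENNReal.ofReal (η ^ k) •
    (volume : Measure (Eucl k)).toSphere.map
      (fun s : Metric.sphere (0 : Eucl k) 1 => η • (s : Eucl k))

/-- The mean value `(1 / |S(η)|) ∫_{S(η)} f dS` over the sphere of radius `η > 0`. -/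
def sphereMean {V : Type*} [NormedAddCommGroup V] [NormedSpace ℝ V] (k : ℕ) (η : ℝ)
    (f : Eucl k → V) : V :=
  ((sphereMeasure k η).real univ)⁻¹ • ∫ m, f m ∂(sphereMeasure k η)

end

/-! For fixed u with |u| = ρ, the function log ω(u, ·) has hyperbolic gradient of constant length
1/ρ and constant hyperbolic Laplacian -k/ρ². Hence ω^α is an eigenfunction for every complex α, with
λ = (αk - α²)/ρ². Averaging over u keeps the equation; by rotation invariance the mean is radial,
and it is 1 at the origin. Every λ arises from some α, so this proves existence. Since |ρs - ηt| is
symmetric in the unit vectors s and t, the mean over u is also the mean over m in S(η), which is the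
form of the integral formulas.

With r = ρt the radial equation reads y'' + k coth(t) y' + λρ² y = 0. A Gronwall-type energy bound
shows that Cauchy data at the singular point 0 determine y. So the eigenfunction is real-valued and
equals the mean of ω^α for each root α of αk - α² = λρ².

If λρ² ≤ k²/4, a root is real, the integrand is positive and there is no zero. If λρ² > k²/4, the
function v = sinh^(k/2) y satisfies v'' = -Qv, where Q tends to λρ² - k²/4 > 0. Sturm comparison
with sines gives the sign changes and the spacing of the zeros. An energy estimate bounds the growth
of v well below sinh^(k/2), so y tends to 0. -/

/-- `y` solves the radial equation `y'' + p coth(t) y' + μ y = 0` on `(0, ∞)`, with derivative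
`z`. -/
structure SolvesRadialODE (p μ : ℝ) (y z : ℝ → ℝ) : Prop where
  hasDerivAt_fst : ∀ t, 0 < t → HasDerivAt y (z t) t
  hasDerivAt_snd : ∀ t, 0 < t →
    HasDerivAt z (-(p * (Real.cosh t / Real.sinh t)) * z t - μ * y t) t

/-! ### Energy estimates and uniqueness for the radial equation. -/

namespace SolvesRadialODE

variable {p μ : ℝ} {y z : ℝ → ℝ}

theorem sub {y₁ z₁ : ℝ → ℝ} (h : SolvesRadialODE p μ y z) (h₁ : SolvesRadialODE p μ y₁ z₁) :
    SolvesRadialODE p μ (fun t => y t - y₁ t) (fun t => z t - z₁ t) where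
  hasDerivAt_fst t ht := (h.hasDerivAt_fst t ht).sub (h₁.hasDerivAt_fst t ht)
  hasDerivAt_snd t ht := by
    refine ((h.hasDerivAt_snd t ht).sub (h₁.hasDerivAt_snd t ht)).congr_deriv ?_
    ring

/-- The exponential weight makes the energy monotone once C is chosen: very negative C for
propagation forward from 0, large positive C for propagation backward. -/
theorem hasDerivAt_energy (h : SolvesRadialODE p μ y z) (C : ℝ) {t : ℝ} (ht : 0 < t) :
    HasDerivAt (fun t => (y t ^ 2 + z t ^ 2) * Real.exp (C * t))
      ((2 * (1 - μ) * (y t * z t) - 2 * p * (Real.cosh t / Real.sinh t) * z t ^ 2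
        + C * (y t ^ 2 + z t ^ 2)) * Real.exp (C * t)) t := by
  have h1 := ((h.hasDerivAt_fst t ht).pow 2).add ((h.hasDerivAt_snd t ht).pow 2)
  have h2 := ((hasDerivAt_id t).const_mul C).exp
  refine (h1.mul h2).congr_deriv ?_
  simp only [Pi.add_apply, Pi.pow_apply, id]
  push_cast
  ring

/-- A solution with vanishing Cauchy data at the singular point `0` vanishes. -/
theorem eq_zero_of_tendsto (hp : 0 ≤ p) (h : SolvesRadialODE p μ y z)
    (hy : Tendsto y (𝓝[>] 0) (𝓝 0)) (hz : Tendsto z (𝓝[>] 0) (𝓝 0)) {t : ℝ} (ht : 0 < t) :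
    y t = 0 := by
  -- Here |2(1 - μ)yz| ≤ (1 + |μ|)(y² + z²), and the coth term only helps because p ≥ 0; so the
  -- singularity at 0 does no harm.
  set C : ℝ := -(1 + |μ|) with hC
  have hanti : AntitoneOn (fun t => (y t ^ 2 + z t ^ 2) * Real.exp (C * t)) (Ioi 0) := by
    refine antitoneOn_of_deriv_nonpos (convex_Ioi 0)
      (fun x hx => (h.hasDerivAt_energy C hx).continuousAt.continuousWithinAt) ?_ ?_ <;>
      rw [interior_Ioi]
    · exact fun x hx => (h.hasDerivAt_energy C hx).differentiableAt.differentiableWithinAt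
    · intro x hx
      rw [(h.hasDerivAt_energy C hx).deriv]
      refine mul_nonpos_of_nonpos_of_nonneg ?_ (Real.exp_pos _).le
      have h1 : 0 ≤ 2 * p * (Real.cosh x / Real.sinh x) * z x ^ 2 := by
        have := Real.sinh_pos_iff.2 hx
        have := Real.cosh_pos x
        positivity
      have h2 := le_abs_self μ
      have h3 := neg_abs_le μ
      have h4 := abs_nonneg μ
      nlinarith [sq_nonneg (y x + z x), sq_nonneg (y x - z x)]
  have hlim : Tendsto (fun t => (y t ^ 2 + z t ^ 2) * Real.exp (C * t)) (𝓝[>] 0) (𝓝 0) := by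
    have h2 : Tendsto (fun t : ℝ => Real.exp (C * t)) (𝓝[>] 0) (𝓝 (Real.exp (C * 0))) :=
      (Continuous.tendsto (by fun_prop) 0).mono_left nhdsWithin_le_nhds
    simpa using ((hy.pow 2).add (hz.pow 2)).mul h2
  have hle : (y t ^ 2 + z t ^ 2) * Real.exp (C * t) ≤ 0 := by
    refine ge_of_tendsto hlim ?_
    filter_upwards [Ioo_mem_nhdsGT ht] with s hs
    exact hanti hs.1 ht hs.2.le
  have := nonpos_of_mul_nonpos_left hle (Real.exp_pos _)
  nlinarith [sq_nonneg (y t), sq_nonneg (z t)]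

/-- A solution with vanishing Cauchy data at some `R > 0` vanishes on `(0, R]`. -/
theorem eq_zero_of_le (hp : 0 ≤ p) (h : SolvesRadialODE p μ y z) {a R : ℝ} (ha : 0 < a)
    (haR : a ≤ R) (hy : y R = 0) (hz : z R = 0) : y a = 0 := by
  -- Backward in time the damping term has the wrong sign. It is absorbed by the last summand, since
  -- coth is decreasing and so at most its value at a.
  set C : ℝ := 1 + |μ| + 2 * p * (Real.cosh a / Real.sinh a) with hC
  have hmono : MonotoneOn (fun t => (y t ^ 2 + z t ^ 2) * Real.exp (C * t)) (Icc a R) := by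
    refine monotoneOn_of_deriv_nonneg (convex_Icc a R) (fun x hx =>
      (h.hasDerivAt_energy C (ha.trans_le hx.1)).continuousAt.continuousWithinAt) ?_ ?_ <;>
      rw [interior_Icc]
    · exact fun x hx =>
        (h.hasDerivAt_energy C (ha.trans hx.1)).differentiableAt.differentiableWithinAt
    · intro x hx
      rw [(h.hasDerivAt_energy C (ha.trans hx.1)).deriv]
      refine mul_nonneg ?_ (Real.exp_pos _).le
      have hsa := Real.sinh_pos_iff.2 ha
      have hsx := Real.sinh_pos_iff.2 (ha.trans hx.1)
      have hcoth : Real.cosh x / Real.sinh x ≤ Real.cosh a / Real.sinh a := by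
        rw [div_le_div_iff₀ hsx hsa]
        have := Real.sinh_pos_iff.2 (sub_pos.2 hx.1)
        rw [Real.sinh_sub] at this
        linarith
      have h1 : 0 ≤ 2 * p * (Real.cosh a / Real.sinh a) * y x ^ 2 := by
        have := Real.cosh_pos a
        positivity
      have h5 : 0 ≤ 2 * p * (Real.cosh a / Real.sinh a - Real.cosh x / Real.sinh x)
          * z x ^ 2 := by
        have := sub_nonneg.2 hcoth
        positivity
      have h2 := le_abs_self μ
      have h3 := neg_abs_le μ
      have h4 := abs_nonneg μ
      nlinarith [sq_nonneg (y x + z x), sq_nonneg (y x - z x)]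
  have hle := hmono (left_mem_Icc.2 haR) (right_mem_Icc.2 haR) haR
  simp only [hy, hz] at hle
  have := nonpos_of_mul_nonpos_left (hle.trans_eq (by simp)) (Real.exp_pos _)
  nlinarith [sq_nonneg (y a), sq_nonneg (z a)]

end SolvesRadialODE

/-! ### Sturm comparison with sines. -/

section Sturm

variable {v w Q : ℝ → ℝ} {a q : ℝ}

/-- This is the Wronskian of v and sin(q(x - a)); while v and the sine are nonnegative, it is
monotone in the direction given by the sign of q² - Q. -/
theorem hasDerivAt_sturmWronskian {t : ℝ} (hv : HasDerivAt v (w t) t)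
    (hw : HasDerivAt w (-Q t * v t) t) :
    HasDerivAt (fun x => w x * Real.sin (q * (x - a)) - q * v x * Real.cos (q * (x - a)))
      ((q ^ 2 - Q t) * v t * Real.sin (q * (t - a))) t := by
  have h0 : HasDerivAt (fun x => q * (x - a)) q t := by
    simpa using ((hasDerivAt_id t).sub_const a).const_mul q
  refine ((hw.mul h0.sin).sub ((hv.const_mul q).mul h0.cos)).congr_deriv ?_
  ring

/-- A nonnegative solution of `v'' = -Q v` on an interval of length `π / q`, where `q ^ 2 ≤ Q`,
vanishes at the left end. -/
theorem eq_zero_left_of_nonneg_of_sq_le (hq : 0 < q)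
    (hv : ∀ t ∈ Icc a (a + Real.pi / q), HasDerivAt v (w t) t)
    (hw : ∀ t ∈ Icc a (a + Real.pi / q), HasDerivAt w (-Q t * v t) t)
    (hQ : ∀ t ∈ Icc a (a + Real.pi / q), q ^ 2 ≤ Q t)
    (hnonneg : ∀ t ∈ Icc a (a + Real.pi / q), 0 ≤ v t) : v a = 0 := by
  have hlen : 0 < Real.pi / q := div_pos Real.pi_pos hq
  have hanti : AntitoneOn
      (fun x => w x * Real.sin (q * (x - a)) - q * v x * Real.cos (q * (x - a)))
      (Icc a (a + Real.pi / q)) := by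
    refine antitoneOn_of_deriv_nonpos (convex_Icc _ _) (fun x hx =>
      (hasDerivAt_sturmWronskian (hv x hx) (hw x hx)).continuousAt.continuousWithinAt) ?_ ?_ <;>
      rw [interior_Icc]
    · exact fun x hx => (hasDerivAt_sturmWronskian (hv x (Ioo_subset_Icc_self hx))
        (hw x (Ioo_subset_Icc_self hx))).differentiableAt.differentiableWithinAt
    · intro x hx'
      have hx := Ioo_subset_Icc_self hx'
      rw [(hasDerivAt_sturmWronskian (hv x hx) (hw x hx)).deriv]
      have hs : 0 ≤ Real.sin (q * (x - a)) := by
        refine Real.sin_nonneg_of_nonneg_of_le_pi (mul_nonneg hq.le (sub_nonneg.2 hx.1)) ?_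
        rw [mul_comm, ← le_div_iff₀ hq]
        linarith [hx.2]
      have := hQ x hx
      exact mul_nonpos_of_nonpos_of_nonneg
        (mul_nonpos_of_nonpos_of_nonneg (by linarith) (hnonneg x hx)) hs
  have ha : a ∈ Icc a (a + Real.pi / q) := left_mem_Icc.2 (by linarith)
  have hb : a + Real.pi / q ∈ Icc a (a + Real.pi / q) := right_mem_Icc.2 (by linarith)
  -- The Wronskian is -q v(a) at the left end and q v(a + π/q) at the right end. Antitonicity gives
  -- q v(a) + q v(a + π/q) ≤ 0 with both terms nonnegative.
  have h := hanti ha hb (by linarith)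
  have h1 : q * (a + Real.pi / q - a) = Real.pi := by field_simp; ring
  simp only [h1, sub_self, mul_zero, Real.sin_pi, Real.sin_zero, Real.cos_pi, Real.cos_zero] at h
  have h2 := mul_nonneg hq.le (hnonneg _ ha)
  have h3 := mul_nonneg hq.le (hnonneg _ hb)
  have h4 : q * v a = 0 := by linarith
  exact (mul_eq_zero.1 h4).resolve_left hq.ne'

theorem HasDerivAt.nonpos_of_pos_left {f : ℝ → ℝ} {f' a b : ℝ} (hab : a < b)
    (hf : HasDerivAt f f' b) (hb : f b = 0) (hpos : ∀ t ∈ Ioo a b, 0 < f t) : f' ≤ 0 := by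
  have h1 : Tendsto (slope f b) (𝓝[<] b) (𝓝 f') :=
    (hasDerivAt_iff_tendsto_slope.1 hf).mono_left
      (nhdsWithin_mono _ fun x (hx : x < b) => hx.ne)
  refine le_of_tendsto h1 ?_
  filter_upwards [Ioo_mem_nhdsLT hab] with t ht
  rw [slope_def_field, hb, sub_zero]
  exact div_nonpos_of_nonneg_of_nonpos (hpos t ht).le (sub_nonpos.2 ht.2.le)

/-- Two zeros between which a solution of `v'' = -Q v` is positive are at distance more than
`π / (2 q)` if `Q < q ^ 2`. -/
theorem lt_sub_of_pos_of_lt_sq (hq : 0 < q) {b : ℝ} (hab : a < b)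
    (hv : ∀ t ∈ Icc a b, HasDerivAt v (w t) t)
    (hw : ∀ t ∈ Icc a b, HasDerivAt w (-Q t * v t) t)
    (hQ : ∀ t ∈ Icc a b, Q t < q ^ 2) (hva : v a = 0) (hvb : v b = 0)
    (hpos : ∀ t ∈ Ioo a b, 0 < v t) : Real.pi / (2 * q) < b - a := by
  -- The constant is half the sharp π/q. On a shorter interval the sine stays positive up to and
  -- including b, so the Wronskian, which starts at 0, ends at w(b) sin(q(b - a)) > 0. This
  -- contradicts w(b) ≤ 0.
  by_contra! hle
  have hlt : q * (b - a) < Real.pi := by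
    have h1 : q * (b - a) ≤ q * (Real.pi / (2 * q)) := mul_le_mul_of_nonneg_left hle hq.le
    have h2 : q * (Real.pi / (2 * q)) = Real.pi / 2 := by field_simp
    linarith [Real.pi_pos]
  have hsin : ∀ x ∈ Ioc a b, 0 < Real.sin (q * (x - a)) := fun x hx =>
    Real.sin_pos_of_pos_of_lt_pi (mul_pos hq (sub_pos.2 hx.1))
      (lt_of_le_of_lt (mul_le_mul_of_nonneg_left (by linarith [hx.2]) hq.le) hlt)
  have hmono : StrictMonoOn
      (fun x => w x * Real.sin (q * (x - a)) - q * v x * Real.cos (q * (x - a)))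
      (Icc a b) := by
    refine strictMonoOn_of_deriv_pos (convex_Icc _ _) (fun x hx =>
      (hasDerivAt_sturmWronskian (hv x hx) (hw x hx)).continuousAt.continuousWithinAt) ?_
    rw [interior_Icc]
    intro x hx
    have hx' := Ioo_subset_Icc_self hx
    rw [(hasDerivAt_sturmWronskian (hv x hx') (hw x hx')).deriv]
    exact mul_pos (mul_pos (sub_pos.2 (hQ x hx')) (hpos x hx)) (hsin x ⟨hx.1, hx.2.le⟩)
  have h := hmono (left_mem_Icc.2 hab.le) (right_mem_Icc.2 hab.le) hab
  have h1 : w b ≤ 0 := (hv b (right_mem_Icc.2 hab.le)).nonpos_of_pos_left hab hvb hpos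
  have h2 := hsin b ⟨hab, le_rfl⟩
  simp only [hva, hvb, sub_self, mul_zero, Real.sin_zero, zero_mul] at h
  nlinarith

end Sturm

theorem forall_pos_or_forall_neg_of_ne_zero {f : ℝ → ℝ} {a b : ℝ} (hf : ContinuousOn f (Ioo a b))
    (hne : ∀ t ∈ Ioo a b, f t ≠ 0) : (∀ t ∈ Ioo a b, 0 < f t) ∨ ∀ t ∈ Ioo a b, f t < 0 := by
  by_contra! ⟨⟨s, hs, hfs⟩, t, ht, hft⟩
  obtain ⟨c, hc, hfc⟩ := isPreconnected_Ioo.intermediate_value hs ht hf ⟨hfs, hft⟩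
  exact hne c hc hfc

/-! ### Liouville normal form: oscillation, spacing of zeros and decay above the threshold. -/

namespace SolvesRadialODE

variable {p μ : ℝ} {y z : ℝ → ℝ}

/-- The potential of the Liouville normal form of the radial equation. -/
noncomputable def liouvillePotential (p μ t : ℝ) : ℝ :=
  μ - p ^ 2 / 4 - p / 2 * (p / 2 - 1) / Real.sinh t ^ 2

theorem hasDerivAt_sinh_rpow {c t : ℝ} (ht : 0 < t) :
    HasDerivAt (fun t => Real.sinh t ^ c)
      (c * (Real.cosh t / Real.sinh t) * Real.sinh t ^ c) t := by
  have hs := Real.sinh_pos_iff.2 ht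
  refine ((Real.hasDerivAt_sinh t).rpow_const (p := c) (Or.inl hs.ne')).congr_deriv ?_
  rw [Real.rpow_sub_one hs.ne']
  ring

theorem hasDerivAt_liouville_fst (h : SolvesRadialODE p μ y z) {t : ℝ} (ht : 0 < t) :
    HasDerivAt (fun t => Real.sinh t ^ (p / 2) * y t)
      (Real.sinh t ^ (p / 2) * (z t + p / 2 * (Real.cosh t / Real.sinh t) * y t)) t := by
  refine ((hasDerivAt_sinh_rpow ht).mul (h.hasDerivAt_fst t ht)).congr_deriv ?_
  ring

/-- The factor sinh^(p/2) is chosen so that the first-order term cancels; cosh² = sinh² + 1 then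
isolates the constant part of the potential. -/
theorem hasDerivAt_liouville_snd (h : SolvesRadialODE p μ y z) {t : ℝ} (ht : 0 < t) :
    HasDerivAt
      (fun t => Real.sinh t ^ (p / 2) * (z t + p / 2 * (Real.cosh t / Real.sinh t) * y t))
      (-liouvillePotential p μ t * (Real.sinh t ^ (p / 2) * y t)) t := by
  have hs := Real.sinh_pos_iff.2 ht
  have hcoth := (Real.hasDerivAt_cosh t).div (Real.hasDerivAt_sinh t) hs.ne'
  refine ((hasDerivAt_sinh_rpow ht).mul ((h.hasDerivAt_snd t ht).add
    ((hcoth.const_mul (p / 2)).mul (h.hasDerivAt_fst t ht)))).congr_deriv ?_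
  simp only [liouvillePotential, Pi.add_apply, Pi.mul_apply, Pi.div_apply]
  generalize Real.sinh t ^ (p / 2) = S
  have hc := Real.cosh_sq t
  field_simp
  ring_nf
  rw [hc]
  ring

/-- The sign of this limit decides between oscillation and non-oscillation, hence the threshold
p²/4. -/
theorem tendsto_liouvillePotential (p μ : ℝ) :
    Tendsto (liouvillePotential p μ) atTop (𝓝 (μ - p ^ 2 / 4)) := by
  have h1 : Tendsto (fun t => Real.sinh t ^ 2) atTop atTop :=
    (tendsto_pow_atTop two_ne_zero).comp
      (tendsto_atTop_mono' _ ((eventually_ge_atTop 0).mono fun t ht => Real.self_le_sinh_iff.2 ht)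
        tendsto_id)
  have h2 := (tendsto_const_nhds (x := μ - p ^ 2 / 4)).sub
    (h1.const_div_atTop (p / 2 * (p / 2 - 1)))
  rwa [sub_zero] at h2

theorem neg (h : SolvesRadialODE p μ y z) :
    SolvesRadialODE p μ (fun t => -y t) (fun t => -z t) where
  hasDerivAt_fst t ht := (h.hasDerivAt_fst t ht).neg
  hasDerivAt_snd t ht := (h.hasDerivAt_snd t ht).neg.congr_deriv (by ring)

/-- Above the threshold, a nontrivial solution takes negative values arbitrarily far out. -/
theorem exists_neg (h : SolvesRadialODE p μ y z) (hp : 0 ≤ p) (hμ : p ^ 2 / 4 < μ)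
    (hne : ∃ t, 0 < t ∧ y t ≠ 0) (R : ℝ) : ∃ t, R < t ∧ y t < 0 := by
  by_contra! hnonneg
  -- Half of the limit of the potential, so that q² lies strictly below the potential far out.
  set q := Real.sqrt ((μ - p ^ 2 / 4) / 2) with hqdef
  have hq : 0 < q := Real.sqrt_pos.2 (by linarith)
  have hq2 : q ^ 2 = (μ - p ^ 2 / 4) / 2 := Real.sq_sqrt (by linarith)
  obtain ⟨N, hN⟩ := eventually_atTop.1
    ((tendsto_liouvillePotential p μ).eventually_const_lt (u := q ^ 2) (by linarith))
  set M := max (max N R) 0 with hM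
  have hMN : N ≤ M := (le_max_left _ _).trans (le_max_left _ _)
  have hMR : R ≤ M := (le_max_right _ _).trans (le_max_left _ _)
  have hM0 : 0 ≤ M := le_max_right _ _
  -- Every a > M is the left end of a comparison interval, so y, and with it z, vanishes identically
  -- beyond M. Backward uniqueness then makes y vanish everywhere.
  have hzero : ∀ a, M < a → y a = 0 := by
    intro a ha
    have hpos : ∀ t ∈ Icc a (a + Real.pi / q), 0 < t := fun t ht => by linarith [ht.1]
    have h0 := eq_zero_left_of_nonneg_of_sq_le hq
      (fun t ht => h.hasDerivAt_liouville_fst (hpos t ht))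
      (fun t ht => h.hasDerivAt_liouville_snd (hpos t ht))
      (fun t ht => (hN t (by linarith [ht.1])).le)
      (fun t ht => mul_nonneg (Real.rpow_nonneg (Real.sinh_pos_iff.2 (hpos t ht)).le _)
        (hnonneg t (by linarith [ht.1])))
    exact (mul_eq_zero.1 h0).resolve_left
      (Real.rpow_pos_of_pos (Real.sinh_pos_iff.2 (by linarith)) _).ne'
  have hzero' : ∀ a, M < a → z a = 0 := fun a ha => by
    have h1 : y =ᶠ[𝓝 a] fun _ => 0 := by
      filter_upwards [Ioi_mem_nhds ha] with t ht using hzero t ht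
    exact (h.hasDerivAt_fst a (by linarith)).unique
      ((hasDerivAt_const a (0 : ℝ)).congr_of_eventuallyEq h1)
  obtain ⟨t, ht, hyt⟩ := hne
  have hlt : M < max t (M + 1) := lt_max_of_lt_right (by linarith)
  exact hyt (h.eq_zero_of_le hp ht (le_max_left t (M + 1)) (hzero _ hlt) (hzero' _ hlt))

/-- Above the threshold, the distances of successive zeros of a solution are eventually bounded
from above and from below. -/
theorem exists_zero_spacing (h : SolvesRadialODE p μ y z) (hμ : p ^ 2 / 4 < μ) :
    ∃ T₁ T₂ N : ℝ, 0 < T₁ ∧ 0 < T₂ ∧ 0 < N ∧ ∀ a b, N < a → a < b → y a = 0 → y b = 0 →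
      (∀ t ∈ Ioo a b, y t ≠ 0) → T₁ < b - a ∧ b - a < T₂ := by
  -- Half and twice the limit of the potential, which eventually lies strictly between q² and q'².
  set q := Real.sqrt ((μ - p ^ 2 / 4) / 2) with hqdef
  set q' := Real.sqrt ((μ - p ^ 2 / 4) * 2) with hqdef'
  have hq : 0 < q := Real.sqrt_pos.2 (by linarith)
  have hq2 : q ^ 2 = (μ - p ^ 2 / 4) / 2 := Real.sq_sqrt (by linarith)
  have hq' : 0 < q' := Real.sqrt_pos.2 (by linarith)
  have hq2' : q' ^ 2 = (μ - p ^ 2 / 4) * 2 := Real.sq_sqrt (by linarith)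
  obtain ⟨N, hN⟩ := eventually_atTop.1
    (((tendsto_liouvillePotential p μ).eventually_const_lt (u := q ^ 2) (by linarith)).and
      ((tendsto_liouvillePotential p μ).eventually_lt_const (u := q' ^ 2) (by linarith)))
  have hpi := div_pos Real.pi_pos hq
  refine ⟨Real.pi / (2 * q'), 2 * (Real.pi / q), max N 1, by positivity, by positivity,
    by positivity, fun a b ha hab hya hyb hne => ?_⟩
  obtain ⟨haN, ha1⟩ := max_lt_iff.1 ha
  suffices key : ∀ y z : ℝ → ℝ, SolvesRadialODE p μ y z → y a = 0 → y b = 0 →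
      (∀ t ∈ Ioo a b, 0 < y t) → Real.pi / (2 * q') < b - a ∧ b - a < 2 * (Real.pi / q) by
    rcases forall_pos_or_forall_neg_of_ne_zero (fun t ht =>
      (h.hasDerivAt_fst t (by linarith [ht.1])).continuousAt.continuousWithinAt) hne with hs | hs
    · exact key y z h hya hyb hs
    · exact key _ _ h.neg (by simp [hya]) (by simp [hyb]) fun t ht => neg_pos.2 (hs t ht)
  intro y z h hya hyb hpos
  have hS : ∀ t, a ≤ t → 0 < Real.sinh t ^ (p / 2) := fun t ht =>
    Real.rpow_pos_of_pos (Real.sinh_pos_iff.2 (by linarith)) _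
  constructor
  · exact lt_sub_of_pos_of_lt_sq hq' hab
      (fun t ht => h.hasDerivAt_liouville_fst (by linarith [ht.1]))
      (fun t ht => h.hasDerivAt_liouville_snd (by linarith [ht.1]))
      (fun t ht => (hN t (by linarith [ht.1])).2) (by simp [hya]) (by simp [hyb])
      fun t ht => mul_pos (hS t ht.1.le) (hpos t ht)
  · by_contra! hle
    -- A gap of at least 2π/q contains a comparison interval of length π/q in its interior. There y
    -- is positive even at the left end, where the comparison forces a zero.
    set c := a + Real.pi / q / 2 with hc
    have hmem : ∀ t ∈ Icc c (c + Real.pi / q), t ∈ Ioo a b := fun t ht =>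
      ⟨by linarith [ht.1], by linarith [ht.2]⟩
    have h0 := eq_zero_left_of_nonneg_of_sq_le hq
      (fun t ht => h.hasDerivAt_liouville_fst (by linarith [(hmem t ht).1]))
      (fun t ht => h.hasDerivAt_liouville_snd (by linarith [(hmem t ht).1]))
      (fun t ht => (hN t (by linarith [(hmem t ht).1])).1.le)
      (fun t ht => (mul_pos (hS t (hmem t ht).1.le) (hpos t (hmem t ht))).le)
    have hcm := hmem c (left_mem_Icc.2 (by linarith))
    exact (mul_pos (hS c hcm.1.le) (hpos c hcm)).ne' h0

/-- Above the threshold, solutions decay at infinity. -/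
theorem tendsto_zero (h : SolvesRadialODE p μ y z) (hp : 0 < p) (hμ : p ^ 2 / 4 < μ) :
    Tendsto y atTop (𝓝 0) := by
  set β := Real.sqrt (μ - p ^ 2 / 4) with hβdef
  have hβ : 0 < β := Real.sqrt_pos.2 (by linarith)
  have hβ2 : β ^ 2 = μ - p ^ 2 / 4 := Real.sq_sqrt (by linarith)
  set d := p / 2 with hd
  have hd0 : 0 < d := by positivity
  have hdβ := mul_pos hd0 hβ
  -- The energy w² + β²v² has derivative 2(β² - Q)vw. The tolerance dβ, with 2β|vw| ≤ w² + β²v²,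
  -- limits its growth to exp(dt). Dividing v² by sinh^p, which is of order exp(2dt), leaves y² =
  -- O(exp(-dt)).
  obtain ⟨N, hN⟩ := eventually_atTop.1
    (((tendsto_liouvillePotential p μ).eventually_const_lt (u := β ^ 2 - d * β)
      (by linarith)).and
      ((tendsto_liouvillePotential p μ).eventually_lt_const (u := β ^ 2 + d * β) (by linarith)))
  set M := max N 1 with hM
  have hM1 : 1 ≤ M := le_max_right _ _
  set v : ℝ → ℝ := fun t => Real.sinh t ^ (p / 2) * y t with hv
  set w : ℝ → ℝ := fun t =>
    Real.sinh t ^ (p / 2) * (z t + p / 2 * (Real.cosh t / Real.sinh t) * y t) with hw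
  have hder : ∀ t, M ≤ t → HasDerivAt (fun t => (w t ^ 2 + β ^ 2 * v t ^ 2) * Real.exp (-d * t))
      ((2 * (β ^ 2 - liouvillePotential p μ t) * (v t * w t)
        - d * (w t ^ 2 + β ^ 2 * v t ^ 2)) * Real.exp (-d * t)) t := by
    intro t ht
    have ht0 : 0 < t := by linarith
    have h1 := h.hasDerivAt_liouville_fst ht0
    have h2 := h.hasDerivAt_liouville_snd ht0
    refine (((h2.pow 2).add ((h1.pow 2).const_mul (β ^ 2))).mul
      ((hasDerivAt_id t).const_mul (-d)).exp).congr_deriv ?_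
    simp only [Pi.add_apply, Pi.pow_apply, id, hv, hw]
    push_cast
    ring
  have hanti : AntitoneOn (fun t => (w t ^ 2 + β ^ 2 * v t ^ 2) * Real.exp (-d * t)) (Ici M) := by
    refine antitoneOn_of_deriv_nonpos (convex_Ici M)
      (fun x hx => (hder x hx).continuousAt.continuousWithinAt) ?_ ?_ <;>
      rw [interior_Ici]
    · exact fun x hx => (hder x (le_of_lt hx)).differentiableAt.differentiableWithinAt
    · intro x hx
      rw [(hder x (le_of_lt hx)).deriv]
      refine mul_nonpos_of_nonpos_of_nonneg ?_ (Real.exp_pos _).le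
      obtain ⟨hQ1, hQ2⟩ := hN x ((le_max_left N 1).trans (le_of_lt hx))
      have h3 : |2 * (β ^ 2 - liouvillePotential p μ x) * (v x * w x)|
          ≤ 2 * (d * β) * |v x * w x| := by
        rw [abs_mul, abs_mul, abs_two]
        refine mul_le_mul_of_nonneg_right ?_ (abs_nonneg _)
        refine mul_le_mul_of_nonneg_left ?_ zero_le_two
        rw [abs_le]
        constructor <;> linarith
      have h4 : 2 * β * |v x * w x| ≤ w x ^ 2 + β ^ 2 * v x ^ 2 := by
        rw [abs_mul, ← sq_abs (w x), ← sq_abs (v x)]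
        nlinarith [sq_nonneg (|w x| - β * |v x|)]
      have h5 := mul_le_mul_of_nonneg_left h4 hd0.le
      have h6 := le_abs_self (2 * (β ^ 2 - liouvillePotential p μ x) * (v x * w x))
      linarith
  set E := (w M ^ 2 + β ^ 2 * v M ^ 2) * Real.exp (-d * M) with hE
  have hbound : ∀ t, M ≤ t → y t ^ 2 ≤ E / β ^ 2 * 4 ^ p * Real.exp (-d * t) := by
    intro t ht
    have ht0 : 0 < t := by linarith
    have h1 : (w t ^ 2 + β ^ 2 * v t ^ 2) * Real.exp (-d * t) ≤ E :=
      hanti (mem_Ici.2 le_rfl) ht ht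
    -- Since t ≥ 1, exp(-t) ≤ 1 ≤ exp(t)/2.
    have hs : Real.exp t / 4 ≤ Real.sinh t := by
      rw [Real.sinh_eq]
      have h2 : 2 ≤ Real.exp t := by
        have := Real.add_one_le_exp t
        linarith
      have h3 : Real.exp (-t) ≤ 1 := Real.exp_le_one_iff.2 (by linarith)
      linarith
    have hs' : Real.exp (p * t) / 4 ^ p ≤ (Real.sinh t ^ (p / 2)) ^ 2 := by
      rw [← Real.rpow_natCast, ← Real.rpow_mul (Real.sinh_pos_iff.2 ht0).le]
      have h3 := Real.rpow_le_rpow (by positivity) hs hp.le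
      rw [Real.div_rpow (Real.exp_pos t).le (by norm_num), ← Real.exp_mul, mul_comm t p] at h3
      convert h3 using 2
      push_cast
      ring
    have h4 : β ^ 2 * (Real.exp (p * t) / 4 ^ p * y t ^ 2) * Real.exp (-d * t) ≤ E := by
      refine le_trans ?_ h1
      refine mul_le_mul_of_nonneg_right ?_ (Real.exp_pos _).le
      have h5 : v t ^ 2 = (Real.sinh t ^ (p / 2)) ^ 2 * y t ^ 2 := by simp only [hv, mul_pow]
      rw [h5]
      have h6 := mul_le_mul_of_nonneg_left
        (mul_le_mul_of_nonneg_right hs' (sq_nonneg (y t))) (sq_nonneg β)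
      nlinarith [sq_nonneg (w t)]
    have h7 : Real.exp (p * t) = Real.exp (d * t) * Real.exp (d * t) := by
      rw [← Real.exp_add, hd]; congr 1; ring
    have h8 : Real.exp (-d * t) = (Real.exp (d * t))⁻¹ := by rw [neg_mul, Real.exp_neg]
    rw [h7, h8] at h4
    rw [h8]
    have h9 := Real.exp_pos (d * t)
    have h10 : (0 : ℝ) < 4 ^ p := by positivity
    have h11 : 0 < β ^ 2 := by positivity
    have h12 : y t ^ 2 = (β ^ 2 * (Real.exp (d * t) * Real.exp (d * t) / 4 ^ p * y t ^ 2)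
        * (Real.exp (d * t))⁻¹) * (4 ^ p / β ^ 2 * (Real.exp (d * t))⁻¹) := by
      field_simp
    rw [h12]
    refine (mul_le_mul_of_nonneg_right h4 (by positivity)).trans_eq ?_
    ring
  have hsq : Tendsto (fun t => y t ^ 2) atTop (𝓝 0) := by
    have hexp : Tendsto (fun t => E / β ^ 2 * 4 ^ p * Real.exp (-d * t)) atTop (𝓝 0) := by
      have h1 : Tendsto (fun t => Real.exp (-d * t)) atTop (𝓝 0) :=
        Real.tendsto_exp_atBot.comp (tendsto_id.const_mul_atTop_of_neg (neg_lt_zero.2 hd0))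
      simpa using h1.const_mul (E / β ^ 2 * 4 ^ p)
    exact tendsto_of_tendsto_of_tendsto_of_le_of_le' tendsto_const_nhds hexp
      (Eventually.of_forall fun t => sq_nonneg _) ((eventually_ge_atTop M).mono hbound)
  have h1 := (Real.continuous_sqrt.tendsto 0).comp hsq
  simp only [Function.comp_def, Real.sqrt_sq_eq_abs, Real.sqrt_zero] at h1
  exact (tendsto_zero_iff_abs_tendsto_zero _).2 h1

end SolvesRadialODE

/-! ### Rotation invariance of spherical means. -/

section Sphere

variable {E : Type*} [NormedAddCommGroup E] [InnerProductSpace ℝ E]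

/-- The action of a linear isometry on the unit sphere. -/
def LinearIsometryEquiv.unitSphereMap (e : E ≃ₗᵢ[ℝ] E) (s : Metric.sphere (0 : E) 1) :
    Metric.sphere (0 : E) 1 :=
  ⟨e s, by simp⟩

theorem LinearIsometryEquiv.continuous_unitSphereMap (e : E ≃ₗᵢ[ℝ] E) :
    Continuous e.unitSphereMap :=
  (e.continuous.comp continuous_subtype_val).subtype_mk _

-- The surface measure of a set is a multiple of the volume of the cone over it, and a linear
-- isometry maps cones to cones and preserves volume.
open scoped Pointwise in
theorem LinearIsometryEquiv.measurePreserving_unitSphereMap [FiniteDimensional ℝ E]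
    [MeasurableSpace E] [BorelSpace E] (e : E ≃ₗᵢ[ℝ] E) :
    MeasurePreserving e.unitSphereMap (volume : Measure E).toSphere
      (volume : Measure E).toSphere := by
  refine ⟨e.continuous_unitSphereMap.measurable, Measure.ext fun s hs => ?_⟩
  rw [Measure.map_apply e.continuous_unitSphereMap.measurable hs,
    Measure.toSphere_apply' _ hs,
    Measure.toSphere_apply' _ (e.continuous_unitSphereMap.measurable hs)]
  congr 1
  have hpre := e.measurePreserving.measure_preimage_equiv (f := e.toMeasurableEquiv)
    (Ioo (0 : ℝ) 1 • (Subtype.val '' s))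
  rw [← hpre]
  congr 1
  ext x
  rw [mem_preimage]
  constructor
  · rintro ⟨r, hr, _, ⟨y, hy, rfl⟩, rfl⟩
    exact ⟨r, hr, _, ⟨e.unitSphereMap y, hy, rfl⟩, by simp [unitSphereMap]⟩
  · rintro ⟨r, hr, _, ⟨y, hy, rfl⟩, hxy⟩
    have hy' : e.unitSphereMap (e.symm.unitSphereMap y) = y :=
      Subtype.ext (e.apply_symm_apply y)
    refine ⟨r, hr, _, ⟨e.symm.unitSphereMap y, by rwa [mem_preimage, hy'], rfl⟩, ?_⟩
    apply e.injective
    exact (e.map_smul r _).trans ((congrArg (r • ·) (e.apply_symm_apply _)).trans hxy)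

/-- Reflect in the hyperplane orthogonal to v - w. -/
theorem exists_linearIsometryEquiv_apply_eq {v w : E} (h : ‖v‖ = ‖w‖) :
    ∃ e : E ≃ₗᵢ[ℝ] E, e v = w := by
  refine ⟨(ℝ ∙ (v - w))ᗮ.reflection, ?_⟩
  exact Submodule.reflection_sub h

/-- Both sides depend only on the common norm and the inner product. This symmetry lets the two
arguments of ω exchange directions. -/
theorem norm_smul_sub_smul_comm {v w : E} (h : ‖v‖ = ‖w‖) (a b : ℝ) :
    ‖a • v - b • w‖ = ‖a • w - b • v‖ := by
  rw [← sq_eq_sq₀ (norm_nonneg _) (norm_nonneg _), norm_sub_sq_real, norm_sub_sq_real,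
    norm_smul, norm_smul, norm_smul, norm_smul, h, real_inner_smul_left, real_inner_smul_left,
    real_inner_smul_right, real_inner_smul_right, real_inner_comm]

end Sphere

/-- The rotation invariant probability measure on the unit sphere. -/
noncomputable def unitSphereProb (k : ℕ) : Measure (Metric.sphere (0 : Eucl k) 1) :=
  ((volume : Measure (Eucl k)).toSphere univ)⁻¹ • (volume : Measure (Eucl k)).toSphere

instance (k : ℕ) : IsProbabilityMeasure (unitSphereProb k) := by
  refine ⟨?_⟩
  rw [unitSphereProb, Measure.smul_apply, smul_eq_mul]
  exact ENNReal.inv_mul_cancel (Measure.measure_univ_ne_zero.2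
    (Measure.toSphere_ne_zero (volume : Measure (Eucl k))))
    (measure_ne_top _ _)

theorem sphereMean_eq_integral {V : Type*} [NormedAddCommGroup V] [NormedSpace ℝ V] (k : ℕ)
    {η : ℝ} (hη : 0 < η) (f : Eucl k → V) :
    sphereMean k η f = ∫ s, f (η • (s : Eucl k)) ∂unitSphereProb k := by
  have hemb : MeasurableEmbedding
      (fun s : Metric.sphere (0 : Eucl k) 1 => η • (s : Eucl k)) :=
    (measurableEmbedding_const_smul₀ hη.ne').comp
      (MeasurableEmbedding.subtype_coe Metric.isClosed_sphere.measurableSet)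
  have hpow : 0 < η ^ k := pow_pos hη k
  rw [sphereMean, sphereMeasure, unitSphereProb, integral_smul_measure, integral_smul_measure,
    hemb.integral_map, measureReal_def, Measure.smul_apply, hemb.map_apply, preimage_univ,
    smul_smul, smul_eq_mul, ENNReal.toReal_mul, ENNReal.toReal_ofReal hpow.le, ENNReal.toReal_inv]
  congr 1
  field_simp

theorem integral_unitSphereProb_comp {V : Type*} [NormedAddCommGroup V] [NormedSpace ℝ V] {k : ℕ}
    (e : Eucl k ≃ₗᵢ[ℝ] Eucl k) (f : Eucl k → V) :
    ∫ s, f (e s) ∂unitSphereProb k = ∫ s, f s ∂unitSphereProb k := by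
  rw [unitSphereProb, integral_smul_measure, integral_smul_measure]
  congr 1
  have hemb : MeasurableEmbedding e.unitSphereMap := by
    refine Continuous.measurableEmbedding e.continuous_unitSphereMap fun x y hxy => ?_
    exact Subtype.ext (e.injective (congrArg Subtype.val hxy))
  exact e.measurePreserving_unitSphereMap.integral_comp hemb fun s => f s

theorem omegaKernel_map {k : ℕ} (e : Eucl k ≃ₗᵢ[ℝ] Eucl k) (u m : Eucl k) :
    omegaKernel (e u) (e m) = omegaKernel u m := by
  rw [omegaKernel, omegaKernel, ← map_sub, e.norm_map, e.norm_map, e.norm_map]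

theorem omegaKernel_smul_smul_comm {k : ℕ} {v w : Eucl k} (h : ‖v‖ = ‖w‖) (a b : ℝ) :
    omegaKernel (a • v) (b • w) = omegaKernel (a • w) (b • v) := by
  rw [omegaKernel, omegaKernel, norm_smul_sub_smul_comm h]
  simp only [norm_smul, h]

/-- The mean of a function of the kernel over its first variable equals the mean over its
second variable. -/
theorem integral_omegaKernel_eq_sphereMean {V : Type*} [NormedAddCommGroup V] [NormedSpace ℝ V]
    {k : ℕ} {ρ η : ℝ} (hρ : 0 < ρ) (hη : 0 < η) {u m : Eucl k} (hu : ‖u‖ = ρ) (hm : ‖m‖ = η)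
    (f : ℝ → V) :
    ∫ s, f (omegaKernel (ρ • (s : Eucl k)) m) ∂unitSphereProb k =
      sphereMean k η fun x => f (omegaKernel u x) := by
  rw [sphereMean_eq_integral k hη]
  have hm1 : ‖η⁻¹ • m‖ = 1 := by rw [norm_smul, hm, norm_inv, Real.norm_of_nonneg hη.le,
    inv_mul_cancel₀ hη.ne']
  have hu1 : ‖ρ⁻¹ • u‖ = 1 := by rw [norm_smul, hu, norm_inv, Real.norm_of_nonneg hρ.le,
    inv_mul_cancel₀ hρ.ne']
  -- Rotate the direction of u to that of m, exchange the directions of the two arguments, then undo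
  -- the rotation by invariance of the kernel.
  obtain ⟨e, he⟩ := exists_linearIsometryEquiv_apply_eq (hu1.trans hm1.symm)
  rw [← integral_unitSphereProb_comp e fun s => f (omegaKernel (ρ • s) m)]
  congr 1
  ext s
  have h1 : m = η • e (ρ⁻¹ • u) := by rw [he, smul_inv_smul₀ hη.ne']
  have h2 : ‖e s‖ = ‖e (ρ⁻¹ • u)‖ := by
    rw [e.norm_map, e.norm_map, hu1]
    simp
  rw [h1, omegaKernel_smul_smul_comm h2, ← map_smul, ← map_smul, omegaKernel_map,
    smul_inv_smul₀ hρ.ne']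

/-! ### Differentiation under an integral over a compact parameter space. -/

section ParametricIntegral

variable {X : Type*} [TopologicalSpace X] [CompactSpace X] [SecondCountableTopology X]
  [MeasurableSpace X] [OpensMeasurableSpace X] {ν : Measure X} [IsFiniteMeasure ν]
  {E : Type} [NormedAddCommGroup E] [NormedSpace ℝ E] [FiniteDimensional ℝ E]
  {V : Type} [NormedAddCommGroup V] [NormedSpace ℝ V]

/-- A constant dominates the derivative: it is jointly continuous on the product of the compact
parameter space and a small closed ball. -/
theorem hasFDerivAt_integral_of_continuousOn {U : Set E} (hU : IsOpen U) {K : X → E → V}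
    {K' : X → E → E →L[ℝ] V} (hK : ∀ m ∈ U, Continuous fun s => K s m)
    (hK' : ContinuousOn (fun q : X × E => K' q.1 q.2) (univ ×ˢ U))
    (hder : ∀ s, ∀ m ∈ U, HasFDerivAt (K s) (K' s m) m) {m : E} (hm : m ∈ U) :
    HasFDerivAt (fun m => ∫ s, K s m ∂ν) (∫ s, K' s m ∂ν) m := by
  have : ProperSpace E := FiniteDimensional.proper ℝ E
  obtain ⟨r, hr, hrU⟩ := Metric.nhds_basis_closedBall.mem_iff.1 (hU.mem_nhds hm)
  have hcomp : IsCompact ((univ : Set X) ×ˢ Metric.closedBall m r) :=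
    isCompact_univ.prod (isCompact_closedBall m r)
  obtain ⟨C, hC⟩ := hcomp.exists_bound_of_continuousOn
    (hK'.mono (prod_mono_right hrU))
  have hint : ∀ x ∈ U, Integrable (fun s => K s x) ν := fun x hx =>
    (hK x hx).integrable_of_hasCompactSupport (HasCompactSupport.of_compactSpace _)
  have hK'c : Continuous fun s => K' s m := by
    rw [← continuousOn_univ]
    exact hK'.comp (f := fun s => (s, m)) (by fun_prop) fun s _ => ⟨mem_univ _, hm⟩
  refine hasFDerivAt_integral_of_dominated_of_fderiv_le (F' := fun m s => K' s m) (bound := fun _ => C)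
    (Metric.closedBall_mem_nhds m hr) ?_ (hint m hm) hK'c.aestronglyMeasurable ?_
    (integrable_const C) ?_
  · filter_upwards [hU.mem_nhds hm] with x hx using (hK x hx).aestronglyMeasurable
  · exact Eventually.of_forall fun s x hx => hC (s, x) ⟨mem_univ _, hx⟩
  · exact Eventually.of_forall fun s x hx => hder s x (hrU hx)

variable {Y : Type} [NormedAddCommGroup Y] {c : X → Y}

omit [SecondCountableTopology X] [NormedSpace ℝ E] [FiniteDimensional ℝ E] in
theorem continuousOn_integral_of_continuousOn (hc : Continuous c) {U : Set E}
    {W : Set (Y × E)} (hUW : ∀ s, ∀ m ∈ U, (c s, m) ∈ W) {G : Y × E → V}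
    (hG : ContinuousOn G W) : ContinuousOn (fun m => ∫ s, G (c s, m) ∂ν) U := by
  refine continuousOn_integral_of_compact_support (f := fun m s => G (c s, m)) isCompact_univ
    ?_ fun p x _ hx => absurd (mem_univ x) hx
  exact hG.comp (f := fun q : E × X => (c q.2, q.1)) (by fun_prop) fun q hq => hUW q.2 q.1 hq.1

variable [NormedSpace ℝ Y]

theorem hasFDerivAt_integral_of_contDiffOn (hc : Continuous c) {U : Set E} (hU : IsOpen U)
    {W : Set (Y × E)} (hW : IsOpen W) (hUW : ∀ s, ∀ m ∈ U, (c s, m) ∈ W) {G : Y × E → V}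
    (hG : ContDiffOn ℝ 1 G W) {m : E} (hm : m ∈ U) :
    HasFDerivAt (fun m => ∫ s, G (c s, m) ∂ν)
      (∫ s, (fderiv ℝ G (c s, m)).comp (ContinuousLinearMap.inr ℝ Y E) ∂ν) m := by
  have hpair : ∀ m : E, Continuous fun s => (c s, m) := fun m => by fun_prop
  refine hasFDerivAt_integral_of_continuousOn hU (K := fun s m => G (c s, m))
    (K' := fun s m => (fderiv ℝ G (c s, m)).comp (ContinuousLinearMap.inr ℝ Y E))
    (fun m hm => ?_) ?_ (fun s m hm => ?_) hm
  · rw [← continuousOn_univ]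
    exact hG.continuousOn.comp (hpair m).continuousOn fun s _ => hUW s m hm
  · have h1 := hG.continuousOn_fderiv_of_isOpen hW le_rfl
    have h2 : ContinuousOn (fun q : X × E => fderiv ℝ G (c q.1, q.2)) (univ ×ˢ U) :=
      h1.comp (by fun_prop) fun q hq => hUW q.1 q.2 hq.2
    exact h2.clm_comp continuousOn_const
  · have h1 : HasFDerivAt G (fderiv ℝ G (c s, m)) (c s, m) :=
      ((hG.contDiffAt (hW.mem_nhds (hUW s m hm))).differentiableAt one_ne_zero).hasFDerivAt
    exact h1.comp m (hasFDerivAt_prodMk_right (c s) m)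

/-- The derivative is an integral of the same shape, with a kernel one order less smooth and values
in `E →L[ℝ] V`; hence the induction with V generalized. Factoring the parameter through c makes
joint smoothness of the kernel meaningful. -/
theorem contDiffOn_integral_of_contDiffOn (hc : Continuous c) {U : Set E}
    (hU : IsOpen U) {W : Set (Y × E)} (hW : IsOpen W) (hUW : ∀ s, ∀ m ∈ U, (c s, m) ∈ W)
    {n : ℕ} {G : Y × E → V} (hG : ContDiffOn ℝ n G W) :
    ContDiffOn ℝ n (fun m => ∫ s, G (c s, m) ∂ν) U := by
  induction n generalizing V with
  | zero =>
    rw [Nat.cast_zero, contDiffOn_zero] at hG ⊢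
    exact continuousOn_integral_of_continuousOn hc hUW hG
  | succ n ih =>
    have hder := fun m (hm : m ∈ U) => hasFDerivAt_integral_of_contDiffOn (ν := ν) hc hU hW hUW
      (hG.of_le (by norm_num)) hm
    have hG' : ContDiffOn ℝ n
        (fun q => (fderiv ℝ G q).comp (ContinuousLinearMap.inr ℝ Y E)) W :=
      (hG.fderiv_of_isOpen hW (by norm_num)).clm_comp contDiffOn_const
    rw [Nat.cast_succ, contDiffOn_succ_iff_fderiv_of_isOpen hU]
    refine ⟨fun m hm => (hder m hm).differentiableAt.differentiableWithinAt,
      fun h => absurd h (by simp), ?_⟩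
    exact (ih hG').congr fun m hm => (hder m hm).fderiv

end ParametricIntegral

/-! ### Powers of ω are eigenfunctions. -/

section Kernel

variable {k : ℕ}

theorem omegaKernel_pos {u m : Eucl k} (h : ‖m‖ < ‖u‖) : 0 < omegaKernel u m := by
  have h1 : 0 < ‖u - m‖ := norm_pos_iff.2 (sub_ne_zero.2 fun h' => by simp [h'] at h)
  have h2 := norm_nonneg m
  exact div_pos (by nlinarith) (by positivity)

theorem omegaKernel_cpow_eq_exp {u m : Eucl k} (h : ‖m‖ < ‖u‖) (α : ℂ) :
    (omegaKernel u m : ℂ) ^ α = Complex.exp (α * (Real.log (omegaKernel u m) : ℝ)) := by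
  have h1 := omegaKernel_pos h
  rw [Complex.cpow_def_of_ne_zero (by exact_mod_cast h1.ne'), Complex.ofReal_log h1.le, mul_comm]

theorem isOpen_setOf_norm_snd_lt_norm_fst :
    IsOpen {q : Eucl k × Eucl k | ‖q.2‖ < ‖q.1‖} :=
  isOpen_lt (by fun_prop) (by fun_prop)

theorem contDiffOn_omegaKernel_cpow (α : ℂ) {n : ℕ} :
    ContDiffOn ℝ n (fun q : Eucl k × Eucl k => (omegaKernel q.1 q.2 : ℂ) ^ α)
      {q | ‖q.2‖ < ‖q.1‖} := by
  have h1 : ContDiffOn ℝ n (fun q : Eucl k × Eucl k => omegaKernel q.1 q.2)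
      {q | ‖q.2‖ < ‖q.1‖} := by
    refine ContDiffOn.div ?_ ?_ fun q hq => ?_
    · exact ((contDiff_fst.norm_sq ℝ).sub (contDiff_snd.norm_sq ℝ)).contDiffOn
    · exact ((contDiff_fst.sub contDiff_snd).norm_sq ℝ).contDiffOn
    · have : 0 < ‖q.1 - q.2‖ := norm_pos_iff.2 (sub_ne_zero.2 fun h' => by
        rw [mem_ofPred_eq, h'] at hq
        exact lt_irrefl _ hq)
      positivity
  have h2 : ContDiffOn ℝ n (fun q : Eucl k × Eucl k => Complex.exp
      (α * (Complex.ofRealCLM (Real.log (omegaKernel q.1 q.2))))) {q | ‖q.2‖ < ‖q.1‖} :=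
    (contDiffOn_const.mul (Complex.ofRealCLM.contDiff.comp_contDiffOn
      (h1.log fun q hq => (omegaKernel_pos hq).ne'))).cexp
  exact h2.congr fun q hq => omegaKernel_cpow_eq_exp hq α

theorem hasDerivAt_norm_sq_add_smul_single (i : Fin (k + 1)) (m : Eucl k) :
    HasDerivAt (fun t : ℝ => ‖m + t • EuclideanSpace.single i (1 : ℝ)‖ ^ 2) (2 * m i) 0 := by
  have h : (fun t : ℝ => ‖m + t • EuclideanSpace.single i (1 : ℝ)‖ ^ 2) =
      fun t => ‖m‖ ^ 2 + 2 * m i * t + t ^ 2 := by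
    ext t
    rw [norm_add_sq_real, norm_smul, real_inner_smul_right, EuclideanSpace.inner_single_right]
    simp
    ring
  rw [h]
  have h2 := (((hasDerivAt_id (0 : ℝ)).const_mul (2 * m i)).const_add (‖m‖ ^ 2)).add
    ((hasDerivAt_id (0 : ℝ)).pow 2)
  refine h2.congr_deriv ?_
  simp

theorem hasDerivAt_apply_add_smul_single (i : Fin (k + 1)) (m : Eucl k) :
    HasDerivAt (fun t : ℝ => (m + t • EuclideanSpace.single i (1 : ℝ)) i) 1 0 := by
  simpa using (hasDerivAt_id (0 : ℝ)).const_add (m i)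

/-- Reduces the Laplacian computations to one-variable calculus along coordinate lines. -/
theorem partialDeriv_eq_of_hasDerivAt {i : Fin (k + 1)} {F : Eucl k → ℂ} {m : Eucl k} {d : ℂ}
    (hF : DifferentiableAt ℝ F m)
    (hd : HasDerivAt (fun t : ℝ => F (m + t • EuclideanSpace.single i (1 : ℝ))) d 0) :
    partialDeriv i F m = d := by
  rw [partialDeriv, ← hF.lineDeriv_eq_fderiv]
  exact hd.deriv

/-- The `i`-th partial derivative of `log ω(u, ·)`. -/
noncomputable def logOmegaDeriv (u : Eucl k) (i : Fin (k + 1)) (m : Eucl k) : ℝ :=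
  -(2 * m i) / (‖u‖ ^ 2 - ‖m‖ ^ 2) - 2 * (m i - u i) / ‖m - u‖ ^ 2

theorem hasDerivAt_log_omegaKernel {u m : Eucl k} (h : ‖m‖ < ‖u‖) (i : Fin (k + 1)) :
    HasDerivAt (fun t : ℝ => Real.log (omegaKernel u (m + t • EuclideanSpace.single i (1 : ℝ))))
      (logOmegaDeriv u i m) 0 := by
  have hA : 0 < ‖u‖ ^ 2 - ‖m‖ ^ 2 := by nlinarith [norm_nonneg m]
  have hD : 0 < ‖m - u‖ := norm_pos_iff.2 (sub_ne_zero.2 fun h' => by simp [h'] at h)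
  have h1 := (hasDerivAt_norm_sq_add_smul_single i m).const_sub (‖u‖ ^ 2)
  have h2 := hasDerivAt_norm_sq_add_smul_single i (m - u)
  have h3 : ∀ t : ℝ, omegaKernel u (m + t • EuclideanSpace.single i (1 : ℝ)) =
      (‖u‖ ^ 2 - ‖m + t • EuclideanSpace.single i (1 : ℝ)‖ ^ 2) /
        ‖m - u + t • EuclideanSpace.single i (1 : ℝ)‖ ^ 2 := by
    intro t
    rw [omegaKernel, norm_sub_rev, add_sub_right_comm]
  have h4 := (h1.fun_div h2 (by simpa using hD.ne')).log
    (by simpa using ⟨hA.ne', fun h' : m - u = 0 => by simp [h'] at hD⟩)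
  simp only [h3]
  refine h4.congr_deriv ?_
  simp only [zero_smul, add_zero, logOmegaDeriv, PiLp.sub_apply]
  field_simp

theorem hasDerivAt_logOmegaDeriv {u m : Eucl k} (h : ‖m‖ < ‖u‖) (i : Fin (k + 1)) :
    HasDerivAt (fun t : ℝ => logOmegaDeriv u i (m + t • EuclideanSpace.single i (1 : ℝ)))
      (-2 / (‖u‖ ^ 2 - ‖m‖ ^ 2) - 4 * m i ^ 2 / (‖u‖ ^ 2 - ‖m‖ ^ 2) ^ 2 - 2 / ‖m - u‖ ^ 2
        + 4 * (m i - u i) ^ 2 / (‖m - u‖ ^ 2) ^ 2) 0 := by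
  have hA : 0 < ‖u‖ ^ 2 - ‖m‖ ^ 2 := by nlinarith [norm_nonneg m]
  have hD : 0 < ‖m - u‖ := norm_pos_iff.2 (sub_ne_zero.2 fun h' => by simp [h'] at h)
  have h1 := (hasDerivAt_norm_sq_add_smul_single i m).const_sub (‖u‖ ^ 2)
  have h2 := hasDerivAt_norm_sq_add_smul_single i (m - u)
  have h3 := hasDerivAt_apply_add_smul_single i m
  have h4 := (((h3.const_mul 2).fun_neg).fun_div h1 (by simpa using hA.ne')).fun_sub
    (((h3.sub_const (u i)).const_mul 2).fun_div h2 (by simpa using hD.ne'))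
  simp only [logOmegaDeriv, add_sub_right_comm m _ u]
  refine h4.congr_deriv ?_
  simp only [zero_smul, add_zero, PiLp.sub_apply]
  field_simp
  ring

theorem contDiffAt_omegaKernel_cpow {u m : Eucl k} (h : ‖m‖ < ‖u‖) (α : ℂ) (n : ℕ) :
    ContDiffAt ℝ n (fun x => (omegaKernel u x : ℂ) ^ α) m := by
  have hq : (u, m) ∈ {q : Eucl k × Eucl k | ‖q.2‖ < ‖q.1‖} := h
  have h1 : ContDiffAt ℝ n (fun q : Eucl k × Eucl k => (omegaKernel q.1 q.2 : ℂ) ^ α) (u, m) :=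
    (contDiffOn_omegaKernel_cpow α).contDiffAt (isOpen_setOf_norm_snd_lt_norm_fst.mem_nhds hq)
  exact ContDiffAt.comp (g := fun q : Eucl k × Eucl k => (omegaKernel q.1 q.2 : ℂ) ^ α)
    (f := fun x => (u, x)) m h1 (contDiffAt_const.prodMk contDiffAt_id)

theorem differentiableAt_omegaKernel_cpow {u m : Eucl k} (h : ‖m‖ < ‖u‖) (α : ℂ) :
    DifferentiableAt ℝ (fun x => (omegaKernel u x : ℂ) ^ α) m :=
  (contDiffAt_omegaKernel_cpow h α 1).differentiableAt (by simp)

theorem eventually_norm_add_smul_lt {u m : Eucl k} (h : ‖m‖ < ‖u‖) (e : Eucl k) :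
    ∀ᶠ t : ℝ in 𝓝 0, ‖m + t • e‖ < ‖u‖ := by
  have h1 : ContinuousAt (fun t : ℝ => ‖m + t • e‖) 0 := by fun_prop
  exact h1.eventually_lt_const (by simpa using h)

theorem hasDerivAt_omegaKernel_cpow {u m : Eucl k} (h : ‖m‖ < ‖u‖) (α : ℂ) (i : Fin (k + 1)) :
    HasDerivAt
      (fun t : ℝ => (omegaKernel u (m + t • EuclideanSpace.single i (1 : ℝ)) : ℂ) ^ α)
      (α * (omegaKernel u m : ℂ) ^ α * (logOmegaDeriv u i m : ℝ)) 0 := by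
  have h1 := ((hasDerivAt_log_omegaKernel h i).ofReal_comp.const_mul α).cexp
  refine (h1.congr_of_eventuallyEq ?_).congr_deriv ?_
  · filter_upwards [eventually_norm_add_smul_lt h (EuclideanSpace.single i 1)] with t ht
    exact omegaKernel_cpow_eq_exp ht α
  · rw [omegaKernel_cpow_eq_exp h]
    simp only [zero_smul, add_zero]
    ring

theorem partialDeriv_omegaKernel_cpow {u m : Eucl k} (h : ‖m‖ < ‖u‖) (α : ℂ)
    (i : Fin (k + 1)) :
    partialDeriv i (fun x => (omegaKernel u x : ℂ) ^ α) m =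
      α * (omegaKernel u m : ℂ) ^ α * (logOmegaDeriv u i m : ℝ) :=
  partialDeriv_eq_of_hasDerivAt (differentiableAt_omegaKernel_cpow h α)
    (hasDerivAt_omegaKernel_cpow h α i)

theorem hasDerivAt_conformalFactor_pow {ρ : ℝ} {m : Eucl k} (h : ‖m‖ < ρ) (n : ℕ)
    (i : Fin (k + 1)) :
    HasDerivAt
      (fun t : ℝ =>
        (conformalFactor k ρ (m + t • EuclideanSpace.single i (1 : ℝ)) : ℂ) ^ n)
      (n * (conformalFactor k ρ m : ℂ) ^ n * (2 * m i / (ρ ^ 2 - ‖m‖ ^ 2) : ℝ)) 0 := by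
  have hA : 0 < ρ ^ 2 - ‖m‖ ^ 2 := by nlinarith [norm_nonneg m]
  have h1 := (hasDerivAt_norm_sq_add_smul_single i m).const_sub (ρ ^ 2)
  have h2 := ((hasDerivAt_const (0 : ℝ) (2 * ρ ^ 2)).fun_div h1
    (by simpa using hA.ne')).fun_pow n
  have h3 : HasDerivAt
      (fun t : ℝ => conformalFactor k ρ (m + t • EuclideanSpace.single i (1 : ℝ)) ^ n)
      (n * conformalFactor k ρ m ^ n * (2 * m i / (ρ ^ 2 - ‖m‖ ^ 2))) 0 := by
    refine h2.congr_deriv ?_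
    simp only [conformalFactor, zero_smul, add_zero]
    generalize ρ ^ 2 - ‖m‖ ^ 2 = A at hA
    cases n with
    | zero => simp
    | succ n =>
      rw [Nat.add_sub_cancel, pow_succ _ n]
      generalize (2 * ρ ^ 2 / A) ^ n = S
      field_simp
      ring
  simpa only [Complex.ofReal_mul, Complex.ofReal_pow, Complex.ofReal_natCast] using h3.ofReal_comp

theorem contDiffAt_conformalFactor_pow {ρ : ℝ} {m : Eucl k} (h : ‖m‖ < ρ) (n : ℕ)
    {j : WithTop ℕ∞} :
    ContDiffAt ℝ j (fun x : Eucl k => (conformalFactor k ρ x : ℂ) ^ n) m := by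
  have hA : 0 < ρ ^ 2 - ‖m‖ ^ 2 := by nlinarith [norm_nonneg m]
  have h1 : ContDiffAt ℝ j (fun x : Eucl k => conformalFactor k ρ x) m :=
    contDiffAt_const.div (contDiffAt_const.sub (contDiff_id.norm_sq ℝ).contDiffAt) hA.ne'
  exact (Complex.ofRealCLM.contDiff.contDiffAt.comp m h1).pow n

theorem contDiffAt_partialDeriv {F : Eucl k → ℂ} {m : Eucl k} (hF : ContDiffAt ℝ 2 F m)
    (i : Fin (k + 1)) : ContDiffAt ℝ 1 (partialDeriv i F) m :=
  (hF.fderiv_right (m := 1) (by norm_num)).clm_apply contDiffAt_const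

/-- With L the i-th partial of log ω, the inner function is α σ^n ω^α L. The product rule gives α L²
from ω^α, the term with n from σ^n, and the derivative of L. -/
theorem partialDeriv_conformalFactor_mul {u m : Eucl k} (h : ‖m‖ < ‖u‖) (α : ℂ) (n : ℕ)
    (i : Fin (k + 1)) :
    partialDeriv i (fun x => (conformalFactor k ‖u‖ x : ℂ) ^ n *
        partialDeriv i (fun x => (omegaKernel u x : ℂ) ^ α) x) m =
      α * (conformalFactor k ‖u‖ m : ℂ) ^ n * (omegaKernel u m : ℂ) ^ α *
        ((α * (logOmegaDeriv u i m ^ 2 : ℝ)) +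
          (n * (2 * m i / (‖u‖ ^ 2 - ‖m‖ ^ 2)) * logOmegaDeriv u i m
          + (-2 / (‖u‖ ^ 2 - ‖m‖ ^ 2) - 4 * m i ^ 2 / (‖u‖ ^ 2 - ‖m‖ ^ 2) ^ 2 - 2 / ‖m - u‖ ^ 2
        + 4 * (m i - u i) ^ 2 / (‖m - u‖ ^ 2) ^ 2) : ℝ)) := by
  refine partialDeriv_eq_of_hasDerivAt ?_ ?_
  · exact ((contDiffAt_conformalFactor_pow h n).mul (contDiffAt_partialDeriv
      (contDiffAt_omegaKernel_cpow h α 2) i)).differentiableAt one_ne_zero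
  · have h1 := (hasDerivAt_conformalFactor_pow h n i).fun_mul
      (((hasDerivAt_omegaKernel_cpow h α i).const_mul α).fun_mul
        (hasDerivAt_logOmegaDeriv h i).ofReal_comp)
    refine (h1.congr_of_eventuallyEq ?_).congr_deriv ?_
    · filter_upwards [eventually_norm_add_smul_lt h (EuclideanSpace.single i 1)] with t ht
      rw [partialDeriv_omegaKernel_cpow ht]
    · simp only [zero_smul, add_zero]
      push_cast
      ring

/-- After division by σ² = 4ρ⁴/(ρ² - |m|²)², with ρ = |u|, the two sums are 1/ρ² and -k/ρ²: the
squared hyperbolic gradient and the hyperbolic Laplacian of log ω, a multiple of a Busemann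
function. -/
theorem sum_logOmegaDeriv_identities {u m : Eucl k} (h : ‖m‖ < ‖u‖) :
    ∑ i, logOmegaDeriv u i m ^ 2 = 4 * ‖u‖ ^ 2 / (‖u‖ ^ 2 - ‖m‖ ^ 2) ^ 2 ∧
    ∑ i, (((k : ℝ) - 1) * (2 * m i / (‖u‖ ^ 2 - ‖m‖ ^ 2)) * logOmegaDeriv u i m
      + (-2 / (‖u‖ ^ 2 - ‖m‖ ^ 2) - 4 * m i ^ 2 / (‖u‖ ^ 2 - ‖m‖ ^ 2) ^ 2 - 2 / ‖m - u‖ ^ 2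
        + 4 * (m i - u i) ^ 2 / (‖m - u‖ ^ 2) ^ 2)) =
      -(4 * k * ‖u‖ ^ 2 / (‖u‖ ^ 2 - ‖m‖ ^ 2) ^ 2) := by
  have hA : 0 < ‖u‖ ^ 2 - ‖m‖ ^ 2 := by nlinarith [norm_nonneg m]
  have hD : 0 < ‖m - u‖ ^ 2 := pow_pos (norm_pos_iff.2 (sub_ne_zero.2 fun h' => by
    simp [h'] at h)) 2
  have hm : ∑ i, m i ^ 2 = ‖m‖ ^ 2 := by simp [EuclideanSpace.norm_sq_eq]
  have hd : ∑ i, (m i - u i) ^ 2 = ‖m - u‖ ^ 2 := by simp [EuclideanSpace.norm_sq_eq]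
  have hu : ∑ i, u i ^ 2 = ‖u‖ ^ 2 := by simp [EuclideanSpace.norm_sq_eq]
  -- Polarization removes the inner product, so both sums become rational in A, D and |u|².
  have hx : ∑ i, 2 * (m i * (m i - u i)) = ‖m‖ ^ 2 + ‖m - u‖ ^ 2 - ‖u‖ ^ 2 := by
    rw [← hm, ← hd, ← hu, ← Finset.sum_add_distrib, ← Finset.sum_sub_distrib]
    exact Finset.sum_congr rfl fun i _ => by ring
  set A := ‖u‖ ^ 2 - ‖m‖ ^ 2 with hAdef
  set D := ‖m - u‖ ^ 2 with hDdef
  have hx' : ∑ i, 2 * (m i * (m i - u i)) = D - A := by rw [hx, hAdef]; ring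
  have hm' : ‖m‖ ^ 2 = ‖u‖ ^ 2 - A := by rw [hAdef]; ring
  constructor
  · have h1 : ∀ i, logOmegaDeriv u i m ^ 2 = 4 / A ^ 2 * m i ^ 2
        + 4 / (A * D) * (2 * (m i * (m i - u i))) + 4 / D ^ 2 * (m i - u i) ^ 2 := fun i => by
      rw [logOmegaDeriv, ← hAdef, ← hDdef]
      field_simp
      ring
    simp only [h1, Finset.sum_add_distrib, ← Finset.mul_sum, hm, hd, hx', hm']
    field_simp
    ring
  · have h1 : ∀ i, ((k : ℝ) - 1) * (2 * m i / A) * logOmegaDeriv u i m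
        + (-2 / A - 4 * m i ^ 2 / A ^ 2 - 2 / D + 4 * (m i - u i) ^ 2 / D ^ 2) =
        -(2 / A + 2 / D) + -(4 * k / A ^ 2) * m i ^ 2
        + -(2 * (k - 1) / (A * D)) * (2 * (m i * (m i - u i)))
        + 4 / D ^ 2 * (m i - u i) ^ 2 := fun i => by
      rw [logOmegaDeriv, ← hAdef, ← hDdef]
      field_simp
      ring
    simp only [h1, Finset.sum_add_distrib, ← Finset.mul_sum, hm, hd, hx', hm', Finset.sum_const,
      Finset.card_univ, Fintype.card_fin, nsmul_eq_mul]
    push_cast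
    field_simp
    ring

/-- The powers of the kernel are eigenfunctions of the hyperbolic Laplacian. -/
theorem hyperbolicLaplacian_omegaKernel_cpow (hk : 1 ≤ k) {u m : Eucl k} (h : ‖m‖ < ‖u‖)
    (α : ℂ) :
    hyperbolicLaplacian k ‖u‖ (fun x => (omegaKernel u x : ℂ) ^ α) m =
      (α ^ 2 - α * k) / (‖u‖ : ℂ) ^ 2 * (omegaKernel u m : ℂ) ^ α := by
  have hA : 0 < ‖u‖ ^ 2 - ‖m‖ ^ 2 := by nlinarith [norm_nonneg m]
  have hu : 0 < ‖u‖ := (norm_nonneg m).trans_lt h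
  obtain ⟨h1, h2⟩ := sum_logOmegaDeriv_identities h
  simp only [hyperbolicLaplacian, partialDeriv_conformalFactor_mul h, ← Finset.mul_sum]
  rw [Finset.sum_add_distrib, ← Finset.mul_sum, ← Complex.ofReal_sum, ← Complex.ofReal_sum,
    Nat.cast_sub hk, Nat.cast_one, h1, h2]
  have hs : (conformalFactor k ‖u‖ m : ℂ) ^ (k + 1) =
      (conformalFactor k ‖u‖ m : ℂ) ^ (k - 1) * (conformalFactor k ‖u‖ m : ℂ) ^ 2 := by
    rw [← pow_add]
    congr 1
    omega
  have hs0 : (conformalFactor k ‖u‖ m : ℂ) ≠ 0 := by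
    rw [Complex.ofReal_ne_zero, conformalFactor]
    positivity
  rw [hs, mul_inv]
  have hs1 := pow_ne_zero (k - 1) hs0
  have hs2 : (conformalFactor k ‖u‖ m : ℂ) ^ 2 =
      4 * (‖u‖ : ℂ) ^ 4 / ((‖u‖ : ℂ) ^ 2 - (‖m‖ : ℂ) ^ 2) ^ 2 := by
    rw [conformalFactor]
    push_cast
    rw [div_pow]
    ring
  have hA' : (‖u‖ : ℂ) ^ 2 - (‖m‖ : ℂ) ^ 2 ≠ 0 := by exact_mod_cast hA.ne'
  have hu' : (‖u‖ : ℂ) ≠ 0 := by exact_mod_cast hu.ne'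
  rw [hs2]
  push_cast
  generalize (conformalFactor k ‖u‖ m : ℂ) ^ (k - 1) = S at hs1 ⊢
  field_simp
  ring

end Kernel

/-! ### The Laplacian of a mean. -/

section MeanLaplacian

variable {k : ℕ} {X : Type*} [TopologicalSpace X] [CompactSpace X] [SecondCountableTopology X]
  [MeasurableSpace X] [OpensMeasurableSpace X] {ν : Measure X} [IsFiniteMeasure ν]
  {c : X → Eucl k} {U : Set (Eucl k)} {W : Set (Eucl k × Eucl k)} {G : Eucl k × Eucl k → ℂ}

theorem partialDeriv_snd_eq {q : Eucl k × Eucl k} (hG : DifferentiableAt ℝ G q)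
    (i : Fin (k + 1)) :
    partialDeriv i (fun x => G (q.1, x)) q.2 =
      fderiv ℝ G q (0, EuclideanSpace.single i 1) := by
  have h1 : HasFDerivAt (fun x => G (q.1, x))
      ((fderiv ℝ G q).comp (ContinuousLinearMap.inr ℝ (Eucl k) (Eucl k))) q.2 :=
    hG.hasFDerivAt.comp (f := fun x => (q.1, x)) q.2 (hasFDerivAt_prodMk_right q.1 q.2)
  rw [partialDeriv, h1.fderiv]
  simp

omit [SecondCountableTopology X] in
theorem integrable_comp_of_continuousOn (hc : Continuous c)
    (hUW : ∀ s, ∀ m ∈ U, (c s, m) ∈ W) (hG : ContinuousOn G W) {m : Eucl k} (hm : m ∈ U) :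
    Integrable (fun s => G (c s, m)) ν := by
  have h1 : Continuous fun s => G (c s, m) := by
    rw [← continuousOn_univ]
    exact hG.comp (f := fun s => (c s, m)) (by fun_prop) fun s _ => hUW s m hm
  exact h1.integrable_of_hasCompactSupport (HasCompactSupport.of_compactSpace _)

omit [SecondCountableTopology X] in
theorem integrable_partialDeriv (hc : Continuous c) (hW : IsOpen W)
    (hUW : ∀ s, ∀ m ∈ U, (c s, m) ∈ W) (hG : ContDiffOn ℝ 1 G W) {m : Eucl k} (hm : m ∈ U)
    (i : Fin (k + 1)) : Integrable (fun s => partialDeriv i (fun x => G (c s, x)) m) ν := by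
  have h1 : ContinuousOn (fun q => fderiv ℝ G q (0, EuclideanSpace.single i 1)) W :=
    (hG.continuousOn_fderiv_of_isOpen hW le_rfl).clm_apply continuousOn_const
  refine (integrable_comp_of_continuousOn (ν := ν) hc hUW h1 hm).congr
    (Eventually.of_forall fun s => ?_)
  exact (partialDeriv_snd_eq ((hG.contDiffAt (hW.mem_nhds (hUW s m hm))).differentiableAt
    one_ne_zero) i).symm

theorem partialDeriv_integral (hc : Continuous c) (hU : IsOpen U) (hW : IsOpen W)
    (hUW : ∀ s, ∀ m ∈ U, (c s, m) ∈ W) (hG : ContDiffOn ℝ 1 G W) {m : Eucl k} (hm : m ∈ U)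
    (i : Fin (k + 1)) :
    partialDeriv i (fun x => ∫ s, G (c s, x) ∂ν) m =
      ∫ s, partialDeriv i (fun x => G (c s, x)) m ∂ν := by
  have h1 := hasFDerivAt_integral_of_contDiffOn (ν := ν) hc hU hW hUW hG hm
  have h2 : ContinuousOn (fun q => (fderiv ℝ G q).comp
      (ContinuousLinearMap.inr ℝ (Eucl k) (Eucl k))) W :=
    (hG.continuousOn_fderiv_of_isOpen hW le_rfl).clm_comp continuousOn_const
  have h3 : Continuous fun s => (fderiv ℝ G (c s, m)).comp
      (ContinuousLinearMap.inr ℝ (Eucl k) (Eucl k)) := by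
    rw [← continuousOn_univ]
    exact h2.comp (f := fun s => (c s, m)) (by fun_prop) fun s _ => hUW s m hm
  rw [partialDeriv, h1.fderiv, ContinuousLinearMap.integral_apply
    (h3.integrable_of_hasCompactSupport (HasCompactSupport.of_compactSpace _))]
  refine integral_congr_ae (Eventually.of_forall fun s => ?_)
  refine Eq.trans ?_ (partialDeriv_snd_eq (q := (c s, m))
    ((hG.contDiffAt (hW.mem_nhds (hUW s m hm))).differentiableAt one_ne_zero) i).symm
  simp

theorem Filter.EventuallyEq.partialDeriv_eq {F₁ F₂ : Eucl k → ℂ} {m : Eucl k}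
    (h : F₁ =ᶠ[𝓝 m] F₂) (i : Fin (k + 1)) : partialDeriv i F₁ m = partialDeriv i F₂ m := by
  rw [partialDeriv, partialDeriv, h.fderiv_eq]

/-- The hyperbolic Laplacian may be taken under the integral sign. -/
theorem hyperbolicLaplacian_integral {ρ : ℝ} (hc : Continuous c)
    (hW : IsOpen W) (hUW : ∀ s, ∀ m ∈ Metric.ball (0 : Eucl k) ρ, (c s, m) ∈ W)
    (hG : ContDiffOn ℝ 2 G W) {m : Eucl k} (hm : m ∈ Metric.ball (0 : Eucl k) ρ) :
    hyperbolicLaplacian k ρ (fun x => ∫ s, G (c s, x) ∂ν) m =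
      ∫ s, hyperbolicLaplacian k ρ (fun x => G (c s, x)) m ∂ν := by
  set U := Metric.ball (0 : Eucl k) ρ with hUdef
  have hU : IsOpen U := Metric.isOpen_ball
  -- The conformal factor is smooth only inside the ball. On the restricted set, G' below is again a
  -- C¹ kernel, so differentiation under the integral applies a second time.
  set W' := W ∩ (univ ×ˢ U) with hW'def
  have hW' : IsOpen W' := hW.inter (isOpen_univ.prod hU)
  have hUW' : ∀ s, ∀ m ∈ U, (c s, m) ∈ W' := fun s m hm => ⟨hUW s m hm, mem_univ _, hm⟩
  have hG1 : ContDiffOn ℝ 1 G W := hG.of_le one_le_two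
  set G' : Fin (k + 1) → Eucl k × Eucl k → ℂ := fun i q =>
    (conformalFactor k ρ q.2 : ℂ) ^ (k - 1) *
      fderiv ℝ G q (0, EuclideanSpace.single i 1) with hG'def
  have hG' : ∀ i, ContDiffOn ℝ 1 (G' i) W' := fun i => by
    refine ContDiffOn.mul (fun q hq => ?_)
      (((hG.fderiv_of_isOpen hW (by norm_num)).clm_apply contDiffOn_const).mono inter_subset_left)
    have hq2 : ‖q.2‖ < ρ := by simpa [hUdef] using hq.2.2
    exact ((contDiffAt_conformalFactor_pow hq2 (k - 1)).comp q
      contDiffAt_snd).contDiffWithinAt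
  have hpt : ∀ i s, ∀ x ∈ U, G' i (c s, x) =
      (conformalFactor k ρ x : ℂ) ^ (k - 1) * partialDeriv i (fun x => G (c s, x)) x := by
    intro i s x hx
    rw [partialDeriv_snd_eq (q := (c s, x))
      ((hG1.contDiffAt (hW.mem_nhds (hUW s x hx))).differentiableAt one_ne_zero) i]
  have hL : ∀ i, partialDeriv i (fun x => (conformalFactor k ρ x : ℂ) ^ (k - 1) *
      partialDeriv i (fun x => ∫ s, G (c s, x) ∂ν) x) m =
      ∫ s, partialDeriv i (fun x => G' i (c s, x)) m ∂ν := fun i => by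
    rw [← partialDeriv_integral hc hU hW' hUW' (hG' i) hm]
    refine Filter.EventuallyEq.partialDeriv_eq ?_ i
    filter_upwards [hU.mem_nhds hm] with x hx
    rw [partialDeriv_integral hc hU hW hUW hG1 hx, ← integral_const_mul]
    exact integral_congr_ae (Eventually.of_forall fun s => (hpt i s x hx).symm)
  rw [hyperbolicLaplacian, Finset.sum_congr rfl fun i _ => hL i, ← integral_finsetSum _
    fun i _ => integrable_partialDeriv hc hW' hUW' (hG' i) hm i, ← integral_const_mul]
  refine integral_congr_ae (Eventually.of_forall fun s => ?_)
  simp only [hyperbolicLaplacian]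
  congr 1
  refine Finset.sum_congr rfl fun i _ => Filter.EventuallyEq.partialDeriv_eq ?_ i
  filter_upwards [hU.mem_nhds hm] with x hx using hpt i s x hx

end MeanLaplacian

/-! ### The mean kernel: smooth, radial, an eigenfunction. -/

section Eigenfunction

variable {k : ℕ} {ρ : ℝ}

/-- The mean of `ω(u, m) ^ α` over all `u` with `|u| = ρ`. -/
noncomputable def meanKernel (k : ℕ) (ρ : ℝ) (α : ℂ) (m : Eucl k) : ℂ :=
  ∫ s : Metric.sphere (0 : Eucl k) 1, (omegaKernel (ρ • (s : Eucl k)) m : ℂ) ^ α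
    ∂unitSphereProb k

theorem norm_smul_sphere (hρ : 0 < ρ) (s : Metric.sphere (0 : Eucl k) 1) :
    ‖ρ • (s : Eucl k)‖ = ρ := by
  rw [norm_smul, Real.norm_of_nonneg hρ.le]
  simp

theorem mem_setOf_norm_lt (hρ : 0 < ρ) (s : Metric.sphere (0 : Eucl k) 1) (m : Eucl k)
    (hm : m ∈ Metric.ball (0 : Eucl k) ρ) :
    (ρ • (s : Eucl k), m) ∈ {q : Eucl k × Eucl k | ‖q.2‖ < ‖q.1‖} := by
  show ‖m‖ < ‖ρ • (s : Eucl k)‖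
  rw [norm_smul_sphere hρ]
  simpa using hm

theorem contDiffOn_meanKernel (hρ : 0 < ρ) (α : ℂ) :
    ContDiffOn ℝ 2 (meanKernel k ρ α) (Metric.ball 0 ρ) :=
  contDiffOn_integral_of_contDiffOn (n := 2) (c := fun s : Metric.sphere (0 : Eucl k) 1 => ρ • (s : Eucl k))
    (G := fun q : Eucl k × Eucl k => (omegaKernel q.1 q.2 : ℂ) ^ α)
    (by fun_prop) Metric.isOpen_ball isOpen_setOf_norm_snd_lt_norm_fst (mem_setOf_norm_lt hρ)
    (contDiffOn_omegaKernel_cpow α)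

theorem hyperbolicLaplacian_meanKernel (hk : 1 ≤ k) (hρ : 0 < ρ) (α : ℂ) {m : Eucl k}
    (hm : m ∈ Metric.ball (0 : Eucl k) ρ) :
    hyperbolicLaplacian k ρ (meanKernel k ρ α) m =
      (α ^ 2 - α * k) / (ρ : ℂ) ^ 2 * meanKernel k ρ α m := by
  have h1 := hyperbolicLaplacian_integral (ν := unitSphereProb k)
    (c := fun s : Metric.sphere (0 : Eucl k) 1 => ρ • (s : Eucl k))
    (G := fun q : Eucl k × Eucl k => (omegaKernel q.1 q.2 : ℂ) ^ α)
    (by fun_prop) isOpen_setOf_norm_snd_lt_norm_fst (mem_setOf_norm_lt hρ)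
    (contDiffOn_omegaKernel_cpow (n := 2) α) hm
  refine h1.trans ?_
  rw [meanKernel, ← integral_const_mul]
  refine integral_congr_ae (Eventually.of_forall fun s => ?_)
  have h2 := hyperbolicLaplacian_omegaKernel_cpow hk (mem_setOf_norm_lt hρ s m hm) α
  simpa only [norm_smul_sphere hρ] using h2

theorem meanKernel_zero (hρ : 0 < ρ) (α : ℂ) : meanKernel k ρ α 0 = 1 := by
  have h : ∀ s : Metric.sphere (0 : Eucl k) 1, omegaKernel (ρ • (s : Eucl k)) 0 = 1 := fun s => by
    rw [omegaKernel, sub_zero, norm_smul_sphere hρ]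
    simp [hρ.ne']
  simp [meanKernel, h]

theorem meanKernel_eq_sphereMean (hρ : 0 < ρ) (α : ℂ) {η : ℝ} (hη : 0 < η) {u m : Eucl k}
    (hu : ‖u‖ = ρ) (hm : ‖m‖ = η) :
    meanKernel k ρ α m = sphereMean k η fun x => (omegaKernel u x : ℂ) ^ α :=
  integral_omegaKernel_eq_sphereMean hρ hη hu hm fun t => (t : ℂ) ^ α

/-- Rewritten as a mean over the second variable with u fixed, the value depends on m only through
its norm. -/
theorem meanKernel_congr_norm (hρ : 0 < ρ) (α : ℂ) {m m' : Eucl k} (h : ‖m‖ = ‖m'‖) :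
    meanKernel k ρ α m = meanKernel k ρ α m' := by
  rcases eq_or_ne m 0 with rfl | hm
  · rw [norm_zero, eq_comm, norm_eq_zero] at h
    rw [h]
  · have hu : ‖ρ • EuclideanSpace.single (0 : Fin (k + 1)) (1 : ℝ)‖ = ρ := by
      rw [norm_smul, Real.norm_of_nonneg hρ.le]
      simp
    rw [meanKernel_eq_sphereMean hρ α (norm_pos_iff.2 hm) hu rfl,
      meanKernel_eq_sphereMean hρ α (norm_pos_iff.2 hm) hu h.symm]

end Eigenfunction

/-! ### The Laplacian of radial functions. -/

section RadialLaplacian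

variable {k : ℕ} {ρ : ℝ}

theorem hasDerivAt_norm_add_smul_single (i : Fin (k + 1)) {m : Eucl k} (hm : m ≠ 0) :
    HasDerivAt (fun t : ℝ => ‖m + t • EuclideanSpace.single i (1 : ℝ)‖) (m i / ‖m‖) 0 := by
  have hpos : 0 < ‖m‖ := norm_pos_iff.2 hm
  have h1 := (hasDerivAt_norm_sq_add_smul_single i m).sqrt (by simpa using hm)
  simp only [Real.sqrt_sq (norm_nonneg _), zero_smul, add_zero] at h1
  refine h1.congr_deriv ?_
  field_simp

theorem eventually_mem_annulus {m : Eucl k} (hm : m ≠ 0) (hmρ : ‖m‖ < ρ) (e : Eucl k) :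
    ∀ᶠ t : ℝ in 𝓝 0, m + t • e ≠ 0 ∧ ‖m + t • e‖ < ρ := by
  have h1 : ContinuousAt (fun t : ℝ => m + t • e) 0 := by fun_prop
  have h2 : ContinuousAt (fun t : ℝ => ‖m + t • e‖) 0 := by fun_prop
  exact (h1.eventually_ne (by simpa using hm)).and
    (h2.eventually_lt_const (by simpa using hmρ))

variable {f : ℝ → ℂ}

theorem partialDeriv_radial (hF : ContDiffOn ℝ 2 (fun x : Eucl k => f ‖x‖) (Metric.ball 0 ρ))
    (hf : ∀ η ∈ Ioo 0 ρ, DifferentiableAt ℝ f η) {m : Eucl k} (hm : m ≠ 0) (hmρ : ‖m‖ < ρ)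
    (i : Fin (k + 1)) :
    partialDeriv i (fun x => f ‖x‖) m = (m i / ‖m‖ : ℝ) * deriv f ‖m‖ := by
  have hpos : 0 < ‖m‖ := norm_pos_iff.2 hm
  refine partialDeriv_eq_of_hasDerivAt ?_ ?_
  · exact (hF.contDiffAt (Metric.isOpen_ball.mem_nhds (by simpa using hmρ))).differentiableAt
      two_ne_zero
  · have h1 : HasDerivAt f (deriv f ‖m‖) ‖m + (0 : ℝ) • EuclideanSpace.single i (1 : ℝ)‖ := by
      simpa using (hf ‖m‖ ⟨hpos, hmρ⟩).hasDerivAt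
    refine (h1.scomp 0 (hasDerivAt_norm_add_smul_single i hm)).congr_deriv ?_
    exact Complex.real_smul

/-- The hyperbolic Laplacian of a radial function. -/
theorem hyperbolicLaplacian_radial (hk : 1 ≤ k)
    (hF : ContDiffOn ℝ 2 (fun x : Eucl k => f ‖x‖) (Metric.ball 0 ρ))
    (hf : ContDiffOn ℝ 2 f (Ioo 0 ρ)) {m : Eucl k} (hm : m ≠ 0) (hmρ : ‖m‖ < ρ) :
    hyperbolicLaplacian k ρ (fun x => f ‖x‖) m =
      ((conformalFactor k ρ m : ℂ) ^ 2)⁻¹ * (deriv (deriv f) ‖m‖ +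
        (k / ‖m‖ + 2 * (k - 1) * ‖m‖ / (ρ ^ 2 - ‖m‖ ^ 2) : ℝ) * deriv f ‖m‖) := by
  have hpos : 0 < ‖m‖ := norm_pos_iff.2 hm
  have hρ : 0 < ρ := hpos.trans hmρ
  have hA : 0 < ρ ^ 2 - ‖m‖ ^ 2 := by nlinarith
  have hdf : ∀ η ∈ Ioo 0 ρ, DifferentiableAt ℝ f η := fun η hη =>
    (hf.contDiffAt (isOpen_Ioo.mem_nhds hη)).differentiableAt two_ne_zero
  have hdf' : DifferentiableAt ℝ (deriv f) ‖m‖ :=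
    ((hf.deriv_of_isOpen (m := 1) isOpen_Ioo (by norm_num)).contDiffAt
      (isOpen_Ioo.mem_nhds ⟨hpos, hmρ⟩)).differentiableAt one_ne_zero
  have hpart : ∀ i : Fin (k + 1),
      partialDeriv i (fun x : Eucl k => (conformalFactor k ρ x : ℂ) ^ (k - 1) *
        partialDeriv i (fun x => f ‖x‖) x) m =
      (conformalFactor k ρ m : ℂ) ^ (k - 1) * (
        (m i ^ 2 : ℝ) * (((2 * (k - 1) / ((ρ ^ 2 - ‖m‖ ^ 2) * ‖m‖) - 1 / ‖m‖ ^ 3 : ℝ) : ℂ)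
            * deriv f ‖m‖
          + (1 / ‖m‖ ^ 2 : ℝ) * deriv (deriv f) ‖m‖) + (1 / ‖m‖ : ℝ) * deriv f ‖m‖) := by
    intro i
    have hmem : m ∈ Metric.ball (0 : Eucl k) ρ := by simpa using hmρ
    refine partialDeriv_eq_of_hasDerivAt ?_ ?_
    · exact ((contDiffAt_conformalFactor_pow hmρ (k - 1)).mul (contDiffAt_partialDeriv
        (hF.contDiffAt (Metric.isOpen_ball.mem_nhds hmem)) i)).differentiableAt one_ne_zero
    · have h1 : HasDerivAt (deriv f) (deriv (deriv f) ‖m‖)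
          ‖m + (0 : ℝ) • EuclideanSpace.single i (1 : ℝ)‖ := by
        simpa using hdf'.hasDerivAt
      have h2 := h1.scomp 0 (hasDerivAt_norm_add_smul_single i hm)
      have h3 := ((hasDerivAt_apply_add_smul_single i m).fun_div
        (hasDerivAt_norm_add_smul_single i hm) (by simpa using hm)).ofReal_comp
      have h4 := (hasDerivAt_conformalFactor_pow hmρ (k - 1) i).fun_mul (h3.fun_mul h2)
      refine (h4.congr_of_eventuallyEq ?_).congr_deriv ?_
      · filter_upwards [eventually_mem_annulus hm hmρ (EuclideanSpace.single i 1)] with t ht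
        rw [partialDeriv_radial hF hdf ht.1 ht.2]
        rfl
      · simp only [zero_smul, add_zero, Nat.cast_sub hk, Nat.cast_one, Function.comp_apply,
          Complex.real_smul]
        have hA' : (ρ : ℂ) ^ 2 - (‖m‖ : ℂ) ^ 2 ≠ 0 := by exact_mod_cast hA.ne'
        have hm' : (‖m‖ : ℂ) ≠ 0 := by exact_mod_cast hpos.ne'
        push_cast
        generalize (ρ : ℂ) ^ 2 - (‖m‖ : ℂ) ^ 2 = A at hA' ⊢
        field_simp
        ring
  have hsum : ∑ i, m i ^ 2 = ‖m‖ ^ 2 := by simp [EuclideanSpace.norm_sq_eq]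
  rw [hyperbolicLaplacian, Finset.sum_congr rfl fun i _ => hpart i, ← Finset.mul_sum,
    Finset.sum_add_distrib, ← Finset.sum_mul, ← Complex.ofReal_sum, hsum, Finset.sum_const,
    Finset.card_univ, Fintype.card_fin, nsmul_eq_mul]
  have hs : (conformalFactor k ρ m : ℂ) ^ (k + 1) =
      (conformalFactor k ρ m : ℂ) ^ (k - 1) * (conformalFactor k ρ m : ℂ) ^ 2 := by
    rw [← pow_add]
    congr 1
    omega
  have hs0 : (conformalFactor k ρ m : ℂ) ≠ 0 := by
    rw [Complex.ofReal_ne_zero, conformalFactor]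
    positivity
  have hs1 := pow_ne_zero (k - 1) hs0
  have hA' : (ρ : ℂ) ^ 2 - (‖m‖ : ℂ) ^ 2 ≠ 0 := by exact_mod_cast hA.ne'
  have hm' : (‖m‖ : ℂ) ≠ 0 := by exact_mod_cast hpos.ne'
  rw [hs, mul_inv]
  push_cast
  generalize (conformalFactor k ρ m : ℂ) ^ (k - 1) = S at hs1 ⊢
  generalize (ρ : ℂ) ^ 2 - (‖m‖ : ℂ) ^ 2 = A at hA' ⊢
  field_simp
  ring

end RadialLaplacian

/-! ### The substitution η = ρ tanh(t/2), for which r(η) = ρt. -/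

section Tanh

theorem Real.hasDerivAt_tanh (t : ℝ) : HasDerivAt Real.tanh (1 - Real.tanh t ^ 2) t := by
  have h : Real.tanh = fun t => Real.sinh t / Real.cosh t := by
    ext t
    exact Real.tanh_eq_sinh_div_cosh t
  have hc := (Real.cosh_pos t).ne'
  have h1 := (Real.hasDerivAt_sinh t).fun_div (Real.hasDerivAt_cosh t) hc
  rw [h]
  refine h1.congr_deriv ?_
  field_simp

theorem Real.cosh_div_sinh_eq_tanh_half {t : ℝ} (ht : 0 < t) :
    Real.cosh t / Real.sinh t = (1 + Real.tanh (t / 2) ^ 2) / (2 * Real.tanh (t / 2)) := by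
  have h1 : t = 2 * (t / 2) := by ring
  have h2 := Real.sinh_pos_iff.2 (half_pos ht)
  have h3 := Real.cosh_pos (t / 2)
  rw [Real.tanh_eq_sinh_div_cosh]
  nth_rw 1 2 [h1]
  rw [Real.cosh_two_mul, Real.sinh_two_mul]
  field_simp

variable {ρ : ℝ}

theorem hyperbolicRadius_eq_artanh (hρ : 0 < ρ) {η : ℝ} (hη : η ∈ Ioo (-ρ) ρ) :
    hyperbolicRadius ρ η = ρ * (2 * Real.artanh (η / ρ)) := by
  have h1 : η / ρ ∈ Icc (-1 : ℝ) 1 := by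
    constructor
    · rw [le_div_iff₀ hρ]; linarith [hη.1]
    · rw [div_le_one hρ]; linarith [hη.2]
  have h2 : ρ - η ≠ 0 := by linarith [hη.2]
  have h3 : (1 + η / ρ) / (1 - η / ρ) = (ρ + η) / (ρ - η) := by
    field_simp
  rw [hyperbolicRadius, Real.artanh_eq_half_log h1, h3]
  ring

theorem hyperbolicRadius_tanh (hρ : 0 < ρ) (t : ℝ) :
    hyperbolicRadius ρ (ρ * Real.tanh (t / 2)) = ρ * t := by
  have h := Real.tanh_bijOn.mapsTo (mem_univ (t / 2))
  rw [hyperbolicRadius_eq_artanh hρ ⟨by nlinarith [h.1], by nlinarith [h.2]⟩,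
    mul_div_cancel_left₀ _ hρ.ne', Real.artanh_tanh]
  ring

theorem mul_tanh_half_mem (hρ : 0 < ρ) {t : ℝ} (ht : 0 < t) :
    ρ * Real.tanh (t / 2) ∈ Ioo 0 ρ := by
  have h := Real.tanh_bijOn.mapsTo (mem_univ (t / 2))
  have h1 : 0 < Real.tanh (t / 2) := by
    rw [Real.tanh_eq_sinh_div_cosh]
    exact div_pos (Real.sinh_pos_iff.2 (half_pos ht)) (Real.cosh_pos _)
  exact ⟨mul_pos hρ h1, by nlinarith [h.2]⟩

theorem hasDerivAt_mul_tanh_half (ρ t : ℝ) : HasDerivAt (fun t => ρ * Real.tanh (t / 2))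
    (ρ * ((1 - Real.tanh (t / 2) ^ 2) * (1 / 2))) t :=
  (HasDerivAt.comp (h₂ := Real.tanh) (h := fun t => t / 2) t (Real.hasDerivAt_tanh (t / 2))
    ((hasDerivAt_id t).div_const 2)).const_mul ρ

end Tanh

/-! ### From the eigenvalue equation to the radial equation. -/

namespace IsNormalizedRadialEigenfunction

variable {k : ℕ} {ρ lam : ℝ} {φ : ℝ → ℂ}

/-- In geodesic polar coordinates, a normalized radial eigenfunction satisfies the radial
equation. -/
theorem exists_hasDerivAt (h : IsNormalizedRadialEigenfunction k ρ lam φ) (hk : 1 ≤ k)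
    (hρ : 0 < ρ) :
    ∃ Z : ℝ → ℂ, (∀ t, 0 < t → HasDerivAt (fun t => φ (ρ * t)) (Z t) t) ∧
      (∀ t, 0 < t → HasDerivAt Z (((-(k * (Real.cosh t / Real.sinh t)) : ℝ) : ℂ) * Z t
        - ((lam * ρ ^ 2 : ℝ) : ℂ) * φ (ρ * t)) t) ∧
      Tendsto (fun t => φ (ρ * t)) (𝓝[>] 0) (𝓝 1) ∧ Tendsto Z (𝓝[>] 0) (𝓝 0) := by
  set e : Eucl k := EuclideanSpace.single 0 1 with he
  have hnorm : ∀ η : ℝ, ‖η • e‖ = |η| := fun η => by simp [he, norm_smul]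
  -- The restriction to a full diameter: using |η| makes f even and C² across 0, so its derivative
  -- vanishes there. This supplies the second Cauchy datum at the singular point.
  set f : ℝ → ℂ := fun η => φ (hyperbolicRadius ρ |η|) with hf
  have hFf : (fun x : Eucl k => f ‖x‖) = fun x => φ (hyperbolicRadius ρ ‖x‖) := by
    ext x
    simp [hf]
  have hF : ContDiffOn ℝ 2 (fun x : Eucl k => f ‖x‖) (Metric.ball 0 ρ) := by
    rw [hFf]
    exact h.contDiffOn
  have hfc : ContDiffOn ℝ 2 f (Ioo (-ρ) ρ) := by
    have h1 : ContDiffOn ℝ 2 (fun η : ℝ => f ‖η • e‖) (Ioo (-ρ) ρ) := by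
      refine hF.comp (f := fun η : ℝ => η • e) (by fun_prop) fun η hη => ?_
      simpa [hnorm, abs_lt] using hη
    refine h1.congr fun η _ => ?_
    simp [hf, hnorm]
  have hfc' : ContDiffOn ℝ 1 (deriv f) (Ioo (-ρ) ρ) :=
    hfc.deriv_of_isOpen isOpen_Ioo (by norm_num)
  have hder : ∀ η ∈ Ioo (-ρ) ρ, HasDerivAt f (deriv f η) η := fun η hη =>
    ((hfc.contDiffAt (isOpen_Ioo.mem_nhds hη)).differentiableAt two_ne_zero).hasDerivAt
  have hder' : ∀ η ∈ Ioo (-ρ) ρ, HasDerivAt (deriv f) (deriv (deriv f) η) η := fun η hη =>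
    ((hfc'.contDiffAt (isOpen_Ioo.mem_nhds hη)).differentiableAt one_ne_zero).hasDerivAt
  have h0mem : (0 : ℝ) ∈ Ioo (-ρ) ρ := ⟨by linarith, hρ⟩
  have hf'0 : deriv f 0 = 0 := by
    have h1 : HasDerivAt f (deriv f 0) (-(0 : ℝ)) := by simpa using hder 0 h0mem
    have h2 := h1.scomp (0 : ℝ) (hasDerivAt_neg (0 : ℝ))
    have h3 : f ∘ Neg.neg = f := by
      ext η
      simp [hf]
    rw [h3] at h2
    have h4 := (hder 0 h0mem).unique h2
    rw [neg_smul, one_smul] at h4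
    exact self_eq_neg.1 h4
  have hmem : ∀ {t : ℝ}, 0 < t → ρ * Real.tanh (t / 2) ∈ Ioo (-ρ) ρ := fun ht =>
    Ioo_subset_Ioo_left (by linarith) (mul_tanh_half_mem hρ ht)
  have hφf : ∀ t, 0 ≤ t → φ (ρ * t) = f (ρ * Real.tanh (t / 2)) := by
    intro t ht
    rcases ht.eq_or_lt with rfl | ht
    · simp [hf, hyperbolicRadius, hρ.ne']
    · simp only [hf]
      rw [abs_of_pos (mul_tanh_half_mem hρ ht).1, hyperbolicRadius_tanh hρ]
  have htanh0 : Tendsto (fun t => ρ * Real.tanh (t / 2)) (𝓝[>] 0) (𝓝 0) := by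
    have h1 := (hasDerivAt_mul_tanh_half ρ 0).continuousAt.tendsto
    simp only [zero_div, Real.tanh_zero, mul_zero] at h1
    exact h1.mono_left nhdsWithin_le_nhds
  have hode : ∀ η ∈ Ioo 0 ρ, deriv (deriv f) η =
      -((k / η + 2 * (k - 1) * η / (ρ ^ 2 - η ^ 2) : ℝ) : ℂ) * deriv f η
        - ((lam * (2 * ρ ^ 2 / (ρ ^ 2 - η ^ 2)) ^ 2 : ℝ) : ℂ) * f η := by
    intro η hη
    have hηe : ‖η • e‖ = η := by rw [hnorm, abs_of_pos hη.1]
    have h1 := hyperbolicLaplacian_radial hk hF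
      (hfc.mono (Ioo_subset_Ioo_left (by linarith))) (m := η • e)
      (by rw [← norm_pos_iff, hηe]; exact hη.1) (by rw [hηe]; exact hη.2)
    have h2 := h.eigen (η • e) (by simpa [hηe] using hη.2)
    rw [← hFf, h1] at h2
    have hA : 0 < ρ ^ 2 - η ^ 2 := by nlinarith [hη.1, hη.2]
    have hσ : (conformalFactor k ρ (η • e) : ℂ) ≠ 0 := by
      rw [Complex.ofReal_ne_zero, conformalFactor, hηe]
      positivity
    have h3 : φ (hyperbolicRadius ρ ‖η • e‖) = f η := by simp only [hf, hnorm]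
    rw [h3, hηe] at h2
    have h4 : ((lam * (2 * ρ ^ 2 / (ρ ^ 2 - η ^ 2)) ^ 2 : ℝ) : ℂ) =
        lam * (conformalFactor k ρ (η • e) : ℂ) ^ 2 := by
      rw [conformalFactor, hηe]
      push_cast
      ring
    rw [h4]
    have h5 := pow_ne_zero 2 hσ
    generalize (conformalFactor k ρ (η • e) : ℂ) ^ 2 = S at h2 h5 ⊢
    have h6 : S * (S⁻¹ * (deriv (deriv f) η + ((k / η + 2 * (k - 1) * η / (ρ ^ 2 - η ^ 2) : ℝ) : ℂ)
        * deriv f η) + lam * f η) = 0 := by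
      rw [h2, mul_zero]
    rw [mul_add, mul_inv_cancel_left₀ h5] at h6
    linear_combination h6
  refine ⟨fun t => (ρ * ((1 - Real.tanh (t / 2) ^ 2) * (1 / 2)) : ℝ) *
    deriv f (ρ * Real.tanh (t / 2)), fun t ht => ?_, fun t ht => ?_, ?_, ?_⟩
  · have h1 := (hder _ (hmem ht)).scomp t (hasDerivAt_mul_tanh_half ρ t)
    rw [Complex.real_smul] at h1
    refine h1.congr_of_eventuallyEq ?_
    filter_upwards [Ioi_mem_nhds ht] with s hs using hφf s (le_of_lt hs)
  · have h1 := (hder' _ (hmem ht)).scomp t (hasDerivAt_mul_tanh_half ρ t)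
    rw [Complex.real_smul] at h1
    have h2 := HasDerivAt.comp (h₂ := Real.tanh) (h := fun t => t / 2) t
      (Real.hasDerivAt_tanh (t / 2)) ((hasDerivAt_id t).div_const 2)
    have h3 := ((((h2.fun_pow 2).const_sub 1).mul_const (1 / 2)).const_mul ρ).ofReal_comp
    refine (h3.mul h1).congr_deriv ?_
    rw [hode _ (mul_tanh_half_mem hρ ht), hφf t ht.le, Real.cosh_div_sinh_eq_tanh_half ht]
    have h4 := (mul_tanh_half_mem hρ ht).1
    have h5 := (mul_tanh_half_mem hρ ht).2
    simp only [Function.comp_apply]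
    set T := Real.tanh (t / 2) with hT
    have h6 : 0 < T := pos_of_mul_pos_right h4 hρ.le
    have h7 : 0 < 1 - T ^ 2 := by
      have : T < 1 := by
        by_contra! h8
        nlinarith
      nlinarith
    have h8 : ρ ^ 2 - (ρ * T) ^ 2 = ρ ^ 2 * (1 - T ^ 2) := by ring
    rw [h8]
    generalize deriv f (ρ * T) = D
    generalize f (ρ * T) = Y
    have hρ' : (ρ : ℂ) ≠ 0 := by exact_mod_cast hρ.ne'
    have hT' : (T : ℂ) ≠ 0 := by exact_mod_cast h6.ne'
    have h7' : 1 - (T : ℂ) ^ 2 ≠ 0 := by exact_mod_cast h7.ne'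
    push_cast
    field_simp
    ring
  · have h1 := ((hder 0 h0mem).continuousAt.tendsto).comp htanh0
    have h2 : f 0 = 1 := by simp [hf, hyperbolicRadius, hρ.ne', h.at_origin]
    rw [h2] at h1
    refine h1.congr' ?_
    filter_upwards [self_mem_nhdsWithin] with t ht using (hφf t (le_of_lt ht)).symm
  · have h1 := ((hder' 0 h0mem).continuousAt.tendsto).comp htanh0
    have h2 : Tendsto (fun t : ℝ => ((ρ * ((1 - Real.tanh (t / 2) ^ 2) * (1 / 2)) : ℝ) : ℂ))
        (𝓝[>] 0) (𝓝 ((ρ * ((1 - Real.tanh (0 / 2) ^ 2) * (1 / 2)) : ℝ) : ℂ)) := by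
      refine Tendsto.mono_left (ContinuousAt.tendsto ?_) nhdsWithin_le_nhds
      have h3 : Continuous Real.tanh :=
        continuous_iff_continuousAt.2 fun t => (Real.hasDerivAt_tanh t).continuousAt
      exact Continuous.continuousAt (by fun_prop)
    simpa [hf'0] using h2.mul h1

end IsNormalizedRadialEigenfunction

/-! ### The mean kernel as a function of hyperbolic distance; positivity for real exponents. -/

section Existence

variable {k : ℕ} {ρ lam : ℝ}

theorem Filter.EventuallyEq.hyperbolicLaplacian_eq {F₁ F₂ : Eucl k → ℂ} {m : Eucl k}
    (h : F₁ =ᶠ[𝓝 m] F₂) (ρ : ℝ) :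
    hyperbolicLaplacian k ρ F₁ m = hyperbolicLaplacian k ρ F₂ m := by
  simp only [hyperbolicLaplacian]
  congr 1
  refine Finset.sum_congr rfl fun i _ => Filter.EventuallyEq.partialDeriv_eq ?_ i
  filter_upwards [h.eventuallyEq_nhds] with x hx
  rw [hx.partialDeriv_eq]

/-- The radial profile of `meanKernel`, as a function of the hyperbolic distance. -/
noncomputable def meanKernelProfile (k : ℕ) (ρ : ℝ) (α : ℂ) (r : ℝ) : ℂ :=
  meanKernel k ρ α ((ρ * Real.tanh (r / ρ / 2)) • EuclideanSpace.single 0 1)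

theorem meanKernelProfile_hyperbolicRadius (hρ : 0 < ρ) (α : ℂ) {m : Eucl k}
    (hm : m ∈ Metric.ball (0 : Eucl k) ρ) :
    meanKernelProfile k ρ α (hyperbolicRadius ρ ‖m‖) = meanKernel k ρ α m := by
  have hm' : ‖m‖ < ρ := by simpa using hm
  have h0 := norm_nonneg m
  refine meanKernel_congr_norm hρ α ?_
  rw [hyperbolicRadius_eq_artanh hρ ⟨by linarith, hm'⟩, mul_div_cancel_left₀ _ hρ.ne',
    mul_div_cancel_left₀ _ two_ne_zero, Real.tanh_artanh ⟨?_, (div_lt_one hρ).2 hm'⟩,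
    mul_div_cancel₀ _ hρ.ne']
  · simp [norm_smul]
  · have := div_nonneg h0 hρ.le
    linarith

theorem isNormalizedRadialEigenfunction_meanKernelProfile (hk : 1 ≤ k) (hρ : 0 < ρ) {α μ : ℂ}
    (hα : α * k - α ^ 2 = μ * (ρ : ℂ) ^ 2) :
    IsNormalizedRadialEigenfunction k ρ μ (meanKernelProfile k ρ α) where
  contDiffOn := (contDiffOn_meanKernel hρ α).congr fun m hm =>
    meanKernelProfile_hyperbolicRadius hρ α hm
  eigen m hm := by
    have h1 : (fun x : Eucl k => meanKernelProfile k ρ α (hyperbolicRadius ρ ‖x‖))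
        =ᶠ[𝓝 m] meanKernel k ρ α := by
      filter_upwards [Metric.isOpen_ball.mem_nhds hm] with x hx
      exact meanKernelProfile_hyperbolicRadius hρ α hx
    have hρ' : (ρ : ℂ) ≠ 0 := by exact_mod_cast hρ.ne'
    rw [h1.hyperbolicLaplacian_eq, meanKernelProfile_hyperbolicRadius hρ α hm,
      hyperbolicLaplacian_meanKernel hk hρ α hm]
    field_simp
    linear_combination -(meanKernel k ρ α m) * hα
  at_origin := by
    rw [meanKernelProfile]
    simpa using meanKernel_zero hρ α

theorem integrable_omegaKernel_cpow (hρ : 0 < ρ) (α : ℂ) {m : Eucl k}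
    (hm : m ∈ Metric.ball (0 : Eucl k) ρ) :
    Integrable (fun s : Metric.sphere (0 : Eucl k) 1 => (omegaKernel (ρ • (s : Eucl k)) m : ℂ) ^ α)
      (unitSphereProb k) :=
  integrable_comp_of_continuousOn (c := fun s : Metric.sphere (0 : Eucl k) 1 => ρ • (s : Eucl k))
    (G := fun q : Eucl k × Eucl k => (omegaKernel q.1 q.2 : ℂ) ^ α) (by fun_prop)
    (mem_setOf_norm_lt hρ) (contDiffOn_omegaKernel_cpow (n := 0) α).continuousOn hm

/-- A real power of the positive kernel is positive, hence so is its integral. -/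
theorem meanKernel_ofReal_ne_zero (hρ : 0 < ρ) (a : ℝ) {m : Eucl k}
    (hm : m ∈ Metric.ball (0 : Eucl k) ρ) : meanKernel k ρ (a : ℂ) m ≠ 0 := by
  have hpos : ∀ s : Metric.sphere (0 : Eucl k) 1, 0 < omegaKernel (ρ • (s : Eucl k)) m :=
    fun s => omegaKernel_pos (mem_setOf_norm_lt hρ s m hm)
  have h1 : ∀ s : Metric.sphere (0 : Eucl k) 1,
      (omegaKernel (ρ • (s : Eucl k)) m : ℂ) ^ (a : ℂ) =
        ((omegaKernel (ρ • (s : Eucl k)) m ^ a : ℝ) : ℂ) := fun s =>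
    (Complex.ofReal_cpow (hpos s).le a).symm
  have h2 : Integrable (fun s : Metric.sphere (0 : Eucl k) 1 =>
      omegaKernel (ρ • (s : Eucl k)) m ^ a) (unitSphereProb k) := by
    have h3 := (integrable_omegaKernel_cpow hρ (a : ℂ) hm).re
    simpa only [h1, RCLike.re_to_complex, Complex.ofReal_re] using h3
  have h4 : 0 < ∫ s : Metric.sphere (0 : Eucl k) 1,
      omegaKernel (ρ • (s : Eucl k)) m ^ a ∂unitSphereProb k := by
    rw [integral_pos_iff_support_of_nonneg (fun s => (Real.rpow_pos_of_pos (hpos s) a).le) h2]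
    have h5 : Function.support (fun s : Metric.sphere (0 : Eucl k) 1 =>
        omegaKernel (ρ • (s : Eucl k)) m ^ a) = univ :=
      eq_univ_of_forall fun s => (Real.rpow_pos_of_pos (hpos s) a).ne'
    rw [h5, measure_univ]
    exact one_pos
  simp only [meanKernel, h1]
  rw [integral_complex_ofReal]
  exact_mod_cast h4.ne'

end Existence

/-! ### Uniqueness, and transfer of the results on the radial equation. -/

namespace IsNormalizedRadialEigenfunction

variable {k : ℕ} {ρ lam : ℝ} {φ ψ : ℝ → ℂ}

theorem exists_solvesRadialODE (h : IsNormalizedRadialEigenfunction k ρ lam φ) (hk : 1 ≤ k)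
    (hρ : 0 < ρ) :
    ∃ z w : ℝ → ℝ, SolvesRadialODE k (lam * ρ ^ 2) (fun t => (φ (ρ * t)).re) z ∧
      SolvesRadialODE k (lam * ρ ^ 2) (fun t => (φ (ρ * t)).im) w ∧
      Tendsto (fun t => (φ (ρ * t)).re) (𝓝[>] 0) (𝓝 1) ∧ Tendsto z (𝓝[>] 0) (𝓝 0) ∧
      Tendsto (fun t => (φ (ρ * t)).im) (𝓝[>] 0) (𝓝 0) ∧ Tendsto w (𝓝[>] 0) (𝓝 0) := by
  obtain ⟨Z, h1, h2, h3, h4⟩ := h.exists_hasDerivAt hk hρ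
  refine ⟨fun t => (Z t).re, fun t => (Z t).im, ⟨fun t ht => ?_, fun t ht => ?_⟩,
    ⟨fun t ht => ?_, fun t ht => ?_⟩, ?_, ?_, ?_, ?_⟩
  · exact Complex.reCLM.hasFDerivAt.comp_hasDerivAt t (h1 t ht)
  · refine (Complex.reCLM.hasFDerivAt.comp_hasDerivAt t (h2 t ht)).congr_deriv ?_
    rw [Complex.reCLM_apply, Complex.sub_re, Complex.re_ofReal_mul, Complex.re_ofReal_mul]
  · exact Complex.imCLM.hasFDerivAt.comp_hasDerivAt t (h1 t ht)
  · refine (Complex.imCLM.hasFDerivAt.comp_hasDerivAt t (h2 t ht)).congr_deriv ?_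
    rw [Complex.imCLM_apply, Complex.sub_im, Complex.im_ofReal_mul, Complex.im_ofReal_mul]
  · exact (Complex.continuous_re.tendsto 1).comp h3
  · exact (Complex.continuous_re.tendsto 0).comp h4
  · exact (Complex.continuous_im.tendsto 1).comp h3
  · exact (Complex.continuous_im.tendsto 0).comp h4

/-- Real and imaginary parts of the difference solve the radial equation with zero Cauchy data at 0.
-/
theorem eqOn (h : IsNormalizedRadialEigenfunction k ρ lam φ)
    (h' : IsNormalizedRadialEigenfunction k ρ lam ψ) (hk : 1 ≤ k) (hρ : 0 < ρ) :
    EqOn φ ψ (Ici 0) := by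
  intro r hr
  rcases (mem_Ici.1 hr).eq_or_lt with rfl | hr
  · rw [h.at_origin, h'.at_origin]
  obtain ⟨z, w, hz, hw, h1, h2, h3, h4⟩ := h.exists_solvesRadialODE hk hρ
  obtain ⟨z', w', hz', hw', h1', h2', h3', h4'⟩ := h'.exists_solvesRadialODE hk hρ
  have ht : 0 < r / ρ := div_pos hr hρ
  have hre := (hz.sub hz').eq_zero_of_tendsto (Nat.cast_nonneg k) (by simpa using h1.sub h1')
    (by simpa using h2.sub h2') ht
  have him := (hw.sub hw').eq_zero_of_tendsto (Nat.cast_nonneg k) (by simpa using h3.sub h3')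
    (by simpa using h4.sub h4') ht
  simp only [mul_div_cancel₀ r hρ.ne', sub_eq_zero] at hre him
  exact Complex.ext hre him

/-- As λ is real, the imaginary part solves the radial equation by itself, with zero Cauchy data at
0. -/
theorem im_eq_zero (h : IsNormalizedRadialEigenfunction k ρ lam φ) (hk : 1 ≤ k) (hρ : 0 < ρ)
    {r : ℝ} (hr : 0 ≤ r) : (φ r).im = 0 := by
  rcases hr.eq_or_lt with rfl | hr
  · simp [h.at_origin]
  obtain ⟨z, w, -, hw, -, -, h3, h4⟩ := h.exists_solvesRadialODE hk hρ
  have := hw.eq_zero_of_tendsto (Nat.cast_nonneg k) h3 h4 (div_pos hr hρ)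
  simpa only [mul_div_cancel₀ r hρ.ne'] using this

theorem eq_zero_iff_re (h : IsNormalizedRadialEigenfunction k ρ lam φ) (hk : 1 ≤ k) (hρ : 0 < ρ)
    {r : ℝ} (hr : 0 ≤ r) : φ r = 0 ↔ (φ r).re = 0 :=
  ⟨fun h0 => by rw [h0, Complex.zero_re], fun h0 => Complex.ext h0 (h.im_eq_zero hk hρ hr)⟩

theorem apply_hyperbolicRadius (h : IsNormalizedRadialEigenfunction k ρ lam φ) (hk : 1 ≤ k)
    (hρ : 0 < ρ) {α : ℂ} (hα : α * k - α ^ 2 = lam * (ρ : ℂ) ^ 2) {m : Eucl k}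
    (hm : m ∈ Metric.ball (0 : Eucl k) ρ) :
    φ (hyperbolicRadius ρ ‖m‖) = meanKernel k ρ α m := by
  have hm' : ‖m‖ < ρ := by simpa using hm
  have h0 : 0 ≤ hyperbolicRadius ρ ‖m‖ := by
    refine mul_nonneg hρ.le (Real.log_nonneg ?_)
    rw [le_div_iff₀ (by linarith)]
    linarith [norm_nonneg m]
  rw [h.eqOn (isNormalizedRadialEigenfunction_meanKernelProfile hk hρ hα) hk hρ h0,
    meanKernelProfile_hyperbolicRadius hρ α hm]

/-- Up to the threshold, αk - α² = λρ² has a real root, and the mean of a real power of ω is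
positive. -/
theorem ne_zero_of_le (h : IsNormalizedRadialEigenfunction k ρ lam φ) (hk : 1 ≤ k) (hρ : 0 < ρ)
    (hlam : lam * ρ ^ 2 ≤ (k : ℝ) ^ 2 / 4) {r : ℝ} (hr : 0 ≤ r) : φ r ≠ 0 := by
  set a : ℝ := k / 2 + Real.sqrt ((k : ℝ) ^ 2 / 4 - lam * ρ ^ 2) with ha
  have hs : Real.sqrt ((k : ℝ) ^ 2 / 4 - lam * ρ ^ 2) ^ 2 = (k : ℝ) ^ 2 / 4 - lam * ρ ^ 2 :=
    Real.sq_sqrt (by linarith)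
  have hα : (a : ℂ) * k - (a : ℂ) ^ 2 = lam * (ρ : ℂ) ^ 2 := by
    have : a * k - a ^ 2 = lam * ρ ^ 2 := by
      rw [ha]
      linear_combination -hs
    exact_mod_cast this
  rw [h.eqOn (isNormalizedRadialEigenfunction_meanKernelProfile hk hρ hα) hk hρ hr]
  refine meanKernel_ofReal_ne_zero hρ a ?_
  have h1 := Real.tanh_bijOn.mapsTo (mem_univ (r / ρ / 2))
  have h2 : |Real.tanh (r / ρ / 2)| < 1 := abs_lt.2 h1
  simp only [mem_ball_zero_iff, norm_smul, norm_mul, Real.norm_eq_abs, abs_of_pos hρ,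
    PiLp.norm_single, norm_one, mul_one]
  nlinarith

theorem exists_re_pos (h : IsNormalizedRadialEigenfunction k ρ lam φ) (hk : 1 ≤ k)
    (hρ : 0 < ρ) : ∃ t, 0 < t ∧ 0 < (φ (ρ * t)).re := by
  obtain ⟨z, w, -, -, h1, -⟩ := h.exists_solvesRadialODE hk hρ
  have h2 : ∀ᶠ t : ℝ in 𝓝[>] 0, 0 < (φ (ρ * t)).re ∧ t ∈ Ioi (0 : ℝ) :=
    (h1.eventually_const_lt one_pos).and self_mem_nhdsWithin
  obtain ⟨t, ht, ht0⟩ := h2.exists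
  exact ⟨t, ht0, ht⟩

theorem exists_sign_changes (h : IsNormalizedRadialEigenfunction k ρ lam φ) (hk : 1 ≤ k)
    (hρ : 0 < ρ) (hlam : (k : ℝ) ^ 2 / 4 < lam * ρ ^ 2) (R : ℝ) :
    ∃ r₁ r₂ : ℝ, R < r₁ ∧ R < r₂ ∧ (φ r₁).re < 0 ∧ 0 < (φ r₂).re := by
  obtain ⟨z, w, hz, -⟩ := h.exists_solvesRadialODE hk hρ
  obtain ⟨t, ht, hne⟩ := h.exists_re_pos hk hρ
  obtain ⟨t₁, ht₁, h₁⟩ := hz.exists_neg (Nat.cast_nonneg k) hlam ⟨t, ht, hne.ne'⟩ (R / ρ)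
  obtain ⟨t₂, ht₂, h₂⟩ := hz.neg.exists_neg (Nat.cast_nonneg k) hlam
    ⟨t, ht, neg_ne_zero.2 hne.ne'⟩ (R / ρ)
  rw [div_lt_iff₀' hρ] at ht₁ ht₂
  exact ⟨ρ * t₁, ρ * t₂, ht₁, ht₂, h₁, neg_lt_zero.1 h₂⟩

theorem exists_zero (h : IsNormalizedRadialEigenfunction k ρ lam φ) (hk : 1 ≤ k)
    (hρ : 0 < ρ) (hlam : (k : ℝ) ^ 2 / 4 < lam * ρ ^ 2) : ∃ r : ℝ, 0 ≤ r ∧ φ r = 0 := by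
  obtain ⟨z, w, hz, -⟩ := h.exists_solvesRadialODE hk hρ
  obtain ⟨r₁, r₂, hr₁, hr₂, h₁, h₂⟩ := h.exists_sign_changes hk hρ hlam 0
  have hcont : ContinuousOn (fun t => (φ (ρ * t)).re) (Ioi 0) := fun t ht =>
    (hz.hasDerivAt_fst t ht).continuousAt.continuousWithinAt
  obtain ⟨t, ht, h0⟩ := isPreconnected_Ioi.intermediate_value (div_pos hr₁ hρ) (div_pos hr₂ hρ)
    hcont (show (0 : ℝ) ∈ _ by
      simp only [mul_div_cancel₀ _ hρ.ne']
      exact ⟨h₁.le, h₂.le⟩)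
  have ht0 : 0 ≤ ρ * t := mul_nonneg hρ.le (le_of_lt ht)
  exact ⟨ρ * t, ht0, (h.eq_zero_iff_re hk hρ ht0).2 h0⟩

theorem tendsto_atTop_zero (h : IsNormalizedRadialEigenfunction k ρ lam φ) (hk : 1 ≤ k)
    (hρ : 0 < ρ) (hlam : (k : ℝ) ^ 2 / 4 < lam * ρ ^ 2) : Tendsto φ atTop (𝓝 0) := by
  obtain ⟨z, w, hz, -⟩ := h.exists_solvesRadialODE hk hρ
  have h1 := (hz.tendsto_zero (by exact_mod_cast hk) hlam).comp
    (tendsto_id.atTop_div_const hρ)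
  have h2 := (Complex.continuous_ofReal.tendsto 0).comp h1
  rw [Complex.ofReal_zero] at h2
  refine h2.congr' ?_
  filter_upwards [eventually_ge_atTop 0] with r hr
  simp only [Function.comp_apply, id, mul_div_cancel₀ r hρ.ne']
  exact Complex.ext rfl (h.im_eq_zero hk hρ hr).symm

theorem exists_zero_spacing (h : IsNormalizedRadialEigenfunction k ρ lam φ) (hk : 1 ≤ k)
    (hρ : 0 < ρ) (hlam : (k : ℝ) ^ 2 / 4 < lam * ρ ^ 2) :
    ∃ T₁ T₂ N : ℝ, 0 < T₁ ∧ 0 < T₂ ∧ 0 < N ∧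
      ∀ r₁ r₂ : ℝ, N < r₁ → r₁ < r₂ → φ r₁ = 0 → φ r₂ = 0 →
        (∀ r ∈ Ioo r₁ r₂, φ r ≠ 0) → T₁ < |r₂ - r₁| ∧ |r₂ - r₁| < T₂ := by
  obtain ⟨z, w, hz, -⟩ := h.exists_solvesRadialODE hk hρ
  obtain ⟨T₁, T₂, N, h1, h2, h3, H⟩ := hz.exists_zero_spacing hlam
  refine ⟨ρ * T₁, ρ * T₂, ρ * N, by positivity, by positivity, by positivity,
    fun r₁ r₂ hr₁ hr hz₁ hz₂ hne => ?_⟩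
  have hpos : 0 < r₁ := (mul_pos hρ h3).trans hr₁
  obtain ⟨h4, h5⟩ := H (r₁ / ρ) (r₂ / ρ) (by rwa [lt_div_iff₀' hρ])
    (div_lt_div_of_pos_right hr hρ) (by simp [mul_div_cancel₀ _ hρ.ne', hz₁])
    (by simp [mul_div_cancel₀ _ hρ.ne', hz₂]) fun t ht h0 => by
      obtain ⟨ht1, ht2⟩ := ht
      rw [div_lt_iff₀' hρ] at ht1
      rw [lt_div_iff₀' hρ] at ht2
      exact hne (ρ * t) ⟨ht1, ht2⟩ ((h.eq_zero_iff_re hk hρ (hpos.trans ht1).le).2 h0)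
  rw [abs_of_pos (sub_pos.2 hr)]
  rw [← sub_div] at h4 h5
  rw [lt_div_iff₀' hρ] at h4
  rw [div_lt_iff₀' hρ] at h5
  exact ⟨h4, h5⟩

end IsNormalizedRadialEigenfunction

/-! ### Explicit forms of the kernel and the main theorem. -/

section Formulas

variable {k : ℕ} {ρ : ℝ}

theorem omegaKernel_eq_cos_angle {u m : Eucl k} {η : ℝ} (hu : ‖u‖ = ρ) (hm : ‖m‖ = η) :
    omegaKernel u m = (ρ ^ 2 - η ^ 2) / (ρ ^ 2 + η ^ 2 +
      2 * η * ρ * Real.cos (Real.pi - InnerProductGeometry.angle u m)) := by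
  rw [omegaKernel, norm_sub_sq_real, ← InnerProductGeometry.cos_angle_mul_norm_mul_norm,
    Real.cos_pi_sub, hu, hm]
  congr 1
  ring

theorem re_omegaKernel_cpow {x : ℝ} (hx : 0 < x) (k : ℕ) (b : ℝ) :
    ((x : ℂ) ^ ((k : ℂ) / 2 + Complex.I * (b : ℂ))).re =
      x ^ ((k : ℝ) / 2) * Real.cos (b * Real.log x) := by
  rw [Complex.cpow_def_of_ne_zero (by exact_mod_cast hx.ne'), ← Complex.ofReal_log hx.le,
    Complex.exp_re, Real.rpow_def_of_pos hx]
  simp [mul_comm]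

end Formulas

theorem mainTheorem8 (k : ℕ) (hk : 1 ≤ k) (ρ : ℝ) (hρ : 0 < ρ) (κ : ℝ) (hκ : κ = -1 / ρ ^ 2)
    (lam : ℝ) :
    -- the normalized radial eigenfunction exists and is unique
    (∃ φ : ℝ → ℂ, IsNormalizedRadialEigenfunction k ρ lam φ ∧
      ∀ ψ : ℝ → ℂ, IsNormalizedRadialEigenfunction k ρ lam ψ → EqOn ψ φ (Ici 0)) ∧
    ∀ φ : ℝ → ℂ, IsNormalizedRadialEigenfunction k ρ lam φ →
      -- it vanishes at a finite radius iff the eigenvalue exceeds the threshold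
      ((∃ r : ℝ, 0 ≤ r ∧ φ r = 0) ↔ lam > -κ * (k : ℝ) ^ 2 / 4) ∧
      (lam > -κ * (k : ℝ) ^ 2 / 4 ↔
        ∃ (α : ℂ) (b : ℝ), (lam : ℂ) = (α * (k : ℂ) - α ^ 2) / (ρ : ℂ) ^ 2 ∧
          α = (k : ℂ) / 2 + Complex.I * (b : ℂ) ∧ b ≠ 0) ∧
      ((∃ r : ℝ, 0 ≤ r ∧ φ r = 0) →
        -- it is real-valued and changes sign infinitely many times
        (∀ r : ℝ, 0 ≤ r → (φ r).im = 0) ∧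
        (∀ R : ℝ, ∃ r₁ r₂ : ℝ, R < r₁ ∧ R < r₂ ∧ (φ r₁).re < 0 ∧ 0 < (φ r₂).re) ∧
        -- it vanishes at infinity
        Tendsto φ atTop (𝓝 0) ∧
        -- spacing of successive zeros
        (∃ T₁ T₂ Λ₀ : ℝ, 0 < T₁ ∧ 0 < T₂ ∧ 0 < Λ₀ ∧
          ∀ r₁ r₂ : ℝ, Λ₀ < r₁ → r₁ < r₂ → φ r₁ = 0 → φ r₂ = 0 →
            (∀ r ∈ Ioo r₁ r₂, φ r ≠ 0) → T₁ < |r₂ - r₁| ∧ |r₂ - r₁| < T₂) ∧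
        -- integral representations
        (∃ b : ℝ, b = Real.sqrt (lam / (-κ) - (k : ℝ) ^ 2 / 4) ∧ 0 < b ∧
          ∀ (u : Eucl k) (η : ℝ), ‖u‖ = ρ → 0 < η → η < ρ →
            φ (hyperbolicRadius ρ η) =
              sphereMean k η (fun m =>
                (omegaKernel u m : ℂ) ^ ((k : ℂ) / 2 + Complex.I * (b : ℂ))) ∧
            φ (hyperbolicRadius ρ η) =
              sphereMean k η (fun m =>
                (omegaKernel u m : ℂ) ^ ((k : ℂ) / 2 - Complex.I * (b : ℂ))) ∧
            φ (hyperbolicRadius ρ η) =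
              ((sphereMean k η (fun m =>
                omegaKernel u m ^ ((k : ℝ) / 2) *
                  Real.cos (Real.sqrt (lam / (-κ) - (k : ℝ) ^ 2 / 4) *
                    Real.log (omegaKernel u m))) : ℝ) : ℂ) ∧
            ∀ m : Eucl k, ‖m‖ = η →
              omegaKernel u m = (ρ ^ 2 - η ^ 2) / (ρ ^ 2 + η ^ 2 +
                2 * η * ρ * Real.cos (Real.pi - InnerProductGeometry.angle u m)))) := by
  have hlamκ : lam / (-κ) = lam * ρ ^ 2 := by
    rw [hκ]
    field_simp
  have hthr : lam > -κ * (k : ℝ) ^ 2 / 4 ↔ (k : ℝ) ^ 2 / 4 < lam * ρ ^ 2 := by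
    have h1 : -κ * (k : ℝ) ^ 2 / 4 = (k : ℝ) ^ 2 / 4 / ρ ^ 2 := by
      rw [hκ]
      field_simp
    rw [h1, gt_iff_lt, div_lt_iff₀ (by positivity)]
  have hρ' : (ρ : ℂ) ≠ 0 := by exact_mod_cast hρ.ne'
  refine ⟨?_, fun φ hφ => ⟨⟨fun ⟨r, hr, h0⟩ => ?_, fun hlam => ?_⟩, ⟨fun hlam => ?_, ?_⟩, ?_⟩⟩
  -- Completing the square: α = k/2 + d with d² = k²/4 - λρ², solvable over ℂ for every λ.
  · obtain ⟨α, hα⟩ : ∃ α : ℂ, α * k - α ^ 2 = lam * (ρ : ℂ) ^ 2 := by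
      obtain ⟨d, hd⟩ := IsAlgClosed.exists_pow_nat_eq
        ((k : ℂ) ^ 2 / 4 - lam * (ρ : ℂ) ^ 2) zero_lt_two
      exact ⟨k / 2 + d, by linear_combination -hd⟩
    have h := isNormalizedRadialEigenfunction_meanKernelProfile hk hρ hα
    exact ⟨_, h, fun ψ hψ => hψ.eqOn h hk hρ⟩
  · rw [hthr]
    by_contra! hle
    exact hφ.ne_zero_of_le hk hρ hle hr h0
  · exact hφ.exists_zero hk hρ (hthr.1 hlam)
  · rw [hthr] at hlam
    have hs := Real.sq_sqrt (sub_pos.2 hlam).le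
    refine ⟨_, Real.sqrt (lam * ρ ^ 2 - (k : ℝ) ^ 2 / 4), ?_, rfl,
      (Real.sqrt_pos.2 (sub_pos.2 hlam)).ne'⟩
    have hs' : (Real.sqrt (lam * ρ ^ 2 - (k : ℝ) ^ 2 / 4) : ℂ) ^ 2 =
        lam * (ρ : ℂ) ^ 2 - (k : ℂ) ^ 2 / 4 := by simpa using congrArg Complex.ofReal hs
    rw [eq_div_iff (pow_ne_zero 2 hρ')]
    linear_combination -hs' + (Real.sqrt (lam * ρ ^ 2 - (k : ℝ) ^ 2 / 4) : ℂ) ^ 2 * Complex.I_sq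
  · rintro ⟨α, b, hα, rfl, hb⟩
    rw [hthr]
    rw [eq_div_iff (pow_ne_zero 2 hρ')] at hα
    have h1 : lam * ρ ^ 2 = (k : ℝ) ^ 2 / 4 + b ^ 2 := by
      have h2 : (lam : ℂ) * (ρ : ℂ) ^ 2 = (k : ℂ) ^ 2 / 4 + (b : ℂ) ^ 2 := by
        linear_combination hα - (b : ℂ) ^ 2 * Complex.I_sq
      exact Complex.ofReal_injective (by simpa using h2)
    have := sq_pos_of_ne_zero hb
    linarith
  · rintro ⟨r, hr, h0⟩
    have hlam : (k : ℝ) ^ 2 / 4 < lam * ρ ^ 2 := by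
      by_contra! hle
      exact hφ.ne_zero_of_le hk hρ hle hr h0
    refine ⟨fun r hr => hφ.im_eq_zero hk hρ hr, hφ.exists_sign_changes hk hρ hlam,
      hφ.tendsto_atTop_zero hk hρ hlam, hφ.exists_zero_spacing hk hρ hlam, _, rfl, ?_, ?_⟩
    · rw [hlamκ]
      exact Real.sqrt_pos.2 (sub_pos.2 hlam)
    intro u η hu hη hηρ
    rw [hlamκ]
    set b := Real.sqrt (lam * ρ ^ 2 - (k : ℝ) ^ 2 / 4) with hb
    have hs : (b : ℂ) ^ 2 = lam * (ρ : ℂ) ^ 2 - (k : ℂ) ^ 2 / 4 := by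
      simpa using congrArg Complex.ofReal (Real.sq_sqrt (sub_pos.2 hlam).le)
    -- Both conjugate exponents solve the same quadratic, so uniqueness identifies the eigenfunction
    -- with either mean.
    have hα₁ : ((k : ℂ) / 2 + Complex.I * b) * k - ((k : ℂ) / 2 + Complex.I * b) ^ 2 =
        lam * (ρ : ℂ) ^ 2 := by linear_combination hs - (b : ℂ) ^ 2 * Complex.I_sq
    have hα₂ : ((k : ℂ) / 2 - Complex.I * b) * k - ((k : ℂ) / 2 - Complex.I * b) ^ 2 =
        lam * (ρ : ℂ) ^ 2 := by linear_combination hs - (b : ℂ) ^ 2 * Complex.I_sq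
    set m : Eucl k := η • EuclideanSpace.single 0 1 with hmdef
    have hm : ‖m‖ = η := by simp [hmdef, norm_smul, abs_of_pos hη]
    have hmball : m ∈ Metric.ball (0 : Eucl k) ρ := by simpa [hm] using hηρ
    have h1 := hφ.apply_hyperbolicRadius hk hρ hα₁ hmball
    have h2 := hφ.apply_hyperbolicRadius hk hρ hα₂ hmball
    have hr : 0 ≤ hyperbolicRadius ρ η := by
      refine mul_nonneg hρ.le (Real.log_nonneg ?_)
      rw [le_div_iff₀ (by linarith)]
      linarith
    rw [hm] at h1 h2
    refine ⟨h1.trans (meanKernel_eq_sphereMean hρ _ hη hu hm),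
      h2.trans (meanKernel_eq_sphereMean hρ _ hη hu hm), ?_,
      fun x hx => omegaKernel_eq_cos_angle hu hx⟩
    rw [← integral_omegaKernel_eq_sphereMean hρ hη hu hm
      fun t => t ^ ((k : ℝ) / 2) * Real.cos (b * Real.log t)]
    -- Since the eigenfunction is real, the cosine formula is the real part of the exponential one.
    refine Complex.ext ?_ (hφ.im_eq_zero hk hρ hr)
    rw [h1, meanKernel, Complex.ofReal_re]
    refine (integral_re (integrable_omegaKernel_cpow hρ _ hmball)).symm.trans ?_
    refine integral_congr_ae (Eventually.of_forall fun s => ?_)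
    exact re_omegaKernel_cpow (omegaKernel_pos (mem_setOf_norm_lt hρ s m hmball)) k b
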